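/- Let $G=(V,E)$ be a finite, simple, connected graph. A set $S\subseteq V$ is m-convex if it contains every vertex of every induced path of $G$ between two vertices of $S$; $\mathfrak m(S)$ denotes the smallest m-convex set containing $S$. An m-halfspace is an m-convex set whose complement is m-convex. For an edge $ab$ let $\mathcal H_{\mathfrak m}(ab)$ be the family of all m-halfspaces $H$ with $a\in H$ and $b\notin H$. Shadow closure. For $A,B\subseteq V$ let $A/B=\{x\in V:\mathfrak m(B\cup\{x\})\cap A\neq\varnothing\}$. Put $A^0=\{a\}$, $B^0=\{b\}$, $A^{i+1}=\mathfrak m(A^i/B^i)$, $B^{i+1}=\mathfrak m(B^i/A^i)$, $A=\bigcup_i A^i$, $B=\bigcup_i B^i$ and $R=V\setminus(A\cup B)$. Let $\partial R$ be the set of vertices of $R$ with a neighbor outside $R$, let $\partial_BA$ be the set of vertices of $A$ with a neighbor in $B$, and define $\partial_AB$ symmetrically. The formula $\Phi(ab)$. It has one Boolean variable $a_x$ for every $x\in R$ and the following constraints: (i) $a_x=a_{x_0}$ whenever $x\in R$, $x_0\in\partial R$ and there are adjacent $u\in\partial_BA$, $v\in\partial_AB$ with $x_0\in\mathfrak m(\{x,u\})\cap\mathfrak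 m(\{x,v\})$; (ii) $a_x\neq a_y$ for distinct non-adjacent $x,y\in\partial R$; (iii) for $x,y\in\partial R$: $a_x=1$ implies $a_y=1$ if there is an induced path $(x,\dots,y,z)$ with $z\in A$, and $a_x=0$ implies $a_y=0$ if there is an induced path $(x,\dots,y,z)$ with $z\in B$. A variable is trivial if it has the same value in all solutions of $\Phi(ab)$. Two nontrivial variables are equivalent if they are equal in all solutions or different in all solutions. Let $C_1,\dots,C_k$ be the sets of vertices corresponding to the equivalence classes. Each is split as $C_i=C_i'\,\dot\cup\,C_i''$ so that the variables of two vertices of $C_i$ are equal in all solutions if they lie in the same part, and different in all solutions otherwise; one part may be empty. Let $A^*$ be the union of $A$ and the set of all $x\in R$ such that $a_x=1$ in all solutions. Cell decomposition. Let the pairs be labelled $(C_i',C_i'')$ and let $\{C_1,\dots,C_k\}$ be partitioned into an ordered sequence of $p\ge 1$ blocks $\mathcal C_1,\dots,\mathcal C_p$, all nonempty (if $k=0$, then $p=1$ and $\mathcal C_1=\varnothing$). Write $\mathcal C_{<\ell}=\bigcup_{j<\ell}\mathcal C_j$ and $\mathcal C_{>\ell}=\bigcup_{j>\ell}\mathcal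 C_j$. This structure is a cell decomposition of $\mathcal H_{\mathfrak m}(ab)$ if a set $H\subseteq V$ belongs to $\mathcal H_{\mathfrak m}(ab)$ if and only if $$H=A^*\cup\Big(\bigcup_{C_i\in\mathcal C_{<\ell}\cup\mathcal C_\ell'}C_i'\Big)\cup\Big(\bigcup_{C_i\in(\mathcal C_\ell\setminus\mathcal C_\ell')\cup\mathcal C_{>\ell}}C_i''\Big)\quad\text{for some }\ell\in\{1,\dots,p\}\text{ and }\mathcal C_\ell'\subseteq\mathcal C_\ell .$$ Theorem. Let $ab$ be an edge of $G$ with $\mathcal H_{\mathfrak m}(ab)\neq\varnothing$. Then $\mathcal H_{\mathfrak m}(ab)$ has a cell decomposition, and for every cell decomposition $(\{C_1',C_1'',\dots,C_k',C_k''\},\mathcal C_1,\dots,\mathcal C_p)$ of $\mathcal H_{\mathfrak m}(ab)$ the VC-dimension of $\mathcal H_{\mathfrak m}(ab)$ (the largest size of a set $S\subseteq V$ such that every subset of $S$ is of the form $H\cap S$ with $H\in\mathcal H_{\mathfrak m}(ab)$) equals $\max_{1\le j\le p}|\mathcal C_j|$. -/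

import Mathlib

namespace Monophonic

variable {V : Type*}

/-- A walk is an induced path if it is a path without chords. -/
def IsInducedPath (G : SimpleGraph V) {u v : V} (p : G.Walk u v) : Prop :=
  p.IsPath ∧ p.IsChordless

/-- The monophonic interval of `u` and `v`: all vertices lying on induced `(u, v)`-paths. -/
def mInterval (G : SimpleGraph V) (u v : V) : Set V :=
  {z | ∃ p : G.Walk u v, IsInducedPath G p ∧ z ∈ p.support}

/-- Monophonically convex sets. -/
def MConvex (G : SimpleGraph V) (S : Set V) : Prop :=
  ∀ u ∈ S, ∀ v ∈ S, mInterval G u v ⊆ S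

/-- The monophonic convex hull: the smallest m-convex set containing `S`. -/
def mHull (G : SimpleGraph V) (S : Set V) : Set V :=
  ⋂₀ {T | MConvex G T ∧ S ⊆ T}

/-- Monophonic halfspaces: m-convex sets with m-convex complement. -/
def IsMHalfspace (G : SimpleGraph V) (H : Set V) : Prop :=
  MConvex G H ∧ MConvex G Hᶜ

open Classical in
/-- The family of all monophonic halfspaces that contain `a` and avoid `b`. -/
noncomputable def halfspaces [Fintype V] (G : SimpleGraph V) (a b : V) : Finset (Finset V) :=
  Finset.univ.filter fun H => IsMHalfspace G (H : Set V) ∧ a ∈ H ∧ b ∉ H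

/-- The shadow `A / B` of `A` with respect to `B`. -/
def shadow (G : SimpleGraph V) (A B : Set V) : Set V :=
  {x | (mHull G (B ∪ {x}) ∩ A).Nonempty}

/-- The iterates `(Aⁱ, Bⁱ)` of `(A, B) ↦ (mHull (A / B), mHull (B / A))`. -/
def shadowIter (G : SimpleGraph V) (A B : Set V) : ℕ → Set V × Set V
  | 0 => (A, B)
  | i + 1 =>
    (mHull G (shadow G (shadowIter G A B i).1 (shadowIter G A B i).2),
      mHull G (shadow G (shadowIter G A B i).2 (shadowIter G A B i).1))

/-- The shadow closure of `(A, B)`: the limit of the increasing iterates. -/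
def shadowClosure (G : SimpleGraph V) (A B : Set V) : Set V × Set V :=
  (⋃ i, (shadowIter G A B i).1, ⋃ i, (shadowIter G A B i).2)

/-- The residue `R = V \ (A ∪ B)` of a pair `(A, B)`. -/
def residue (A B : Set V) : Set V := (A ∪ B)ᶜ

/-- The boundary of `S`: the vertices of `S` having a neighbor outside `S`. -/
def boundary (G : SimpleGraph V) (S : Set V) : Set V :=
  {u | u ∈ S ∧ ∃ v, v ∉ S ∧ G.Adj u v}

/-- The boundary of `A` with respect to `B`: the vertices of `A` having a neighbor in `B`. -/
def relBoundary (G : SimpleGraph V) (A B : Set V) : Set V :=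
  {u | u ∈ A ∧ ∃ v ∈ B, G.Adj u v}

/-- The set `S_x`: those `x₀ ∈ ∂R` for which there is an edge `uv` between `A` and `B` such that
`x₀` lies in both `mHull {x, u}` and `mHull {x, v}`. -/
def separatorSet (G : SimpleGraph V) (A B : Set V) (x : V) : Set V :=
  {x₀ | x₀ ∈ boundary G (residue A B) ∧ ∃ u ∈ relBoundary G A B, ∃ v ∈ relBoundary G B A,
    G.Adj u v ∧ x₀ ∈ mHull G {x, u} ∩ mHull G {x, v}}

/-- `x` `A`-implies `y`: there is an induced path `(x, …, y, z)` with `z ∈ A`. -/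
def Implies (G : SimpleGraph V) (A : Set V) (x y : V) : Prop :=
  ∃ z ∈ A, ∃ (q : G.Walk x y) (h : G.Adj y z), IsInducedPath G (q.concat h)

/-- `α` is a solution of the 2-SAT formula of the pair `(A, B)`. The formula has one Boolean
variable for each vertex of the residue; the values of `α` outside the residue play no role. -/
structure IsSolution (G : SimpleGraph V) (A B : Set V) (α : V → Bool) : Prop where
  /-- equality constraints -/
  equality : ∀ x ∈ residue A B, ∀ x₀ ∈ separatorSet G A B x, α x = α x₀
  /-- difference constraints -/
  difference : ∀ x ∈ boundary G (residue A B), ∀ y ∈ boundary G (residue A B),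
    x ≠ y → ¬ G.Adj x y → α x ≠ α y
  /-- implication constraints towards `A` -/
  impliesA : ∀ x ∈ boundary G (residue A B), ∀ y ∈ boundary G (residue A B),
    Implies G A x y → α x = true → α y = true
  /-- implication constraints towards `B` -/
  impliesB : ∀ x ∈ boundary G (residue A B), ∀ y ∈ boundary G (residue A B),
    Implies G B x y → α x = false → α y = false

/-- The set `A` of the shadow closure `(A, B)` of `({a}, {b})`. -/
def sideA (G : SimpleGraph V) (a b : V) : Set V := (shadowClosure G {a} {b}).1

/-- The set `B` of the shadow closure `(A, B)` of `({a}, {b})`. -/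
def sideB (G : SimpleGraph V) (a b : V) : Set V := (shadowClosure G {a} {b}).2

/-- `α` is a solution of the 2-SAT formula `Φ(ab)` of the edge `ab`. -/
def Solves (G : SimpleGraph V) (a b : V) (α : V → Bool) : Prop :=
  IsSolution G (sideA G a b) (sideB G a b) α

/-- The vertices whose variable is nontrivial, that is, takes both values in the solutions
of `Φ(ab)`. -/
def nontrivialVars (G : SimpleGraph V) (a b : V) : Set V :=
  {x | x ∈ residue (sideA G a b) (sideB G a b) ∧
    (∃ α, Solves G a b α ∧ α x = true) ∧ ∃ α, Solves G a b α ∧ α x = false}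

/-- The set `A*`: the side `A` together with the vertices whose (trivial) variable has the value
`true` in all solutions of `Φ(ab)`. -/
def core (G : SimpleGraph V) (a b : V) : Set V :=
  sideA G a b ∪ {x | x ∈ residue (sideA G a b) (sideB G a b) ∧ ∀ α, Solves G a b α → α x = true}

/-- The twin cells `C'₁, C''₁, …, C'ₖ, C''ₖ` of `ab`, with their unions `Cᵢ = C'ᵢ ∪ C''ᵢ`
distributed over an ordered sequence of `p` blocks. The `Cᵢ` are the equivalence classes of
the nontrivial variables of `Φ(ab)` (two of them being equivalent if they are equal in all solutions
or different in all solutions), and `C'ᵢ, C''ᵢ` are the two groups of such a class, one of which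
may be empty. The blocks are nonempty, except that there is a single empty block
if there are no cells. -/
structure CellPartition (G : SimpleGraph V) (a b : V) where
  /-- the number of pairs of twin cells -/
  k : ℕ
  /-- the number of blocks -/
  p : ℕ
  /-- the cells `C'ᵢ` -/
  left : Fin k → Set V
  /-- the cells `C''ᵢ` -/
  right : Fin k → Set V
  /-- the index of the block that contains `Cᵢ` -/
  block : Fin k → Fin p
  nonempty : ∀ i, (left i ∪ right i).Nonempty
  disjoint_twin : ∀ i, Disjoint (left i) (right i)
  disjoint : ∀ i j, i ≠ j → Disjoint (left i ∪ right i) (left j ∪ right j)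
  cover : ⋃ i, (left i ∪ right i) = nontrivialVars G a b
  same_iff : ∀ x ∈ nontrivialVars G a b, ∀ y ∈ nontrivialVars G a b,
    (∃ i, (x ∈ left i ∧ y ∈ left i) ∨ (x ∈ right i ∧ y ∈ right i)) ↔
      ∀ α, Solves G a b α → α x = α y
  diff_iff : ∀ x ∈ nontrivialVars G a b, ∀ y ∈ nontrivialVars G a b,
    (∃ i, (x ∈ left i ∧ y ∈ right i) ∨ (x ∈ right i ∧ y ∈ left i)) ↔
      ∀ α, Solves G a b α → α x ≠ α y
  block_surjective : 0 < k → Function.Surjective block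
  single_block : k = 0 → p = 1

namespace CellPartition

variable {G : SimpleGraph V} {a b : V}

/-- The `j`-th block, as a set of indices of the `Cᵢ`. -/
def blockSet (D : CellPartition G a b) (j : Fin D.p) : Finset (Fin D.k) :=
  Finset.univ.filter fun i => D.block i = j

/-- The set obtained from `A*` by taking `C'ᵢ` for all `Cᵢ` in the blocks before `l` and for
all `i ∈ S`, and `C''ᵢ` for the other `Cᵢ` of block `l` and all `Cᵢ` in the blocks after `l`. -/
def assemble (D : CellPartition G a b) (l : Fin D.p) (S : Finset (Fin D.k)) : Set V :=
  core G a b ∪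
    (⋃ i ∈ {i | D.block i < l ∨ i ∈ S}, D.left i) ∪
    (⋃ i ∈ {i | i ∈ D.blockSet l \ S ∨ l < D.block i}, D.right i)

/-- The cells and blocks form a cell decomposition if the sets of the above form are exactly the
monophonic halfspaces containing `a` and avoiding `b`. -/
def IsCellDecomposition [Fintype V] (D : CellPartition G a b) : Prop :=
  ∀ H : Finset V, H ∈ halfspaces G a b ↔
    ∃ l : Fin D.p, ∃ S : Finset (Fin D.k), S ⊆ D.blockSet l ∧ (H : Set V) = D.assemble l S

end CellPartition

end Monophonic

/-!
Write `(A, B)` for the shadow closure of the edge `ab`, `R` for its residue and `∂R` for the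
boundary of `R`.

**Halfspaces are the solutions of `Φ(ab)`.** Every vertex of `∂R` is adjacent to all vertices of
`A` with a neighbor in `B` and to all vertices of `B` with a neighbor in `A`
(`IsShadowClosed.adj_relBoundary_right`): otherwise an induced path through `A` would put it into
the shadow `A / B`. Hence the constraints hold for each halfspace. Conversely, the equality
constraints make a solution constant along edges that leave an interior vertex of `R`
(`IsShadowClosed.eq_of_adj`). An induced path that leaves the set of a solution through outside
vertices and comes back then has its ends in `A` or in `∂R`, and convexity of `A`, a difference
constraint or an implication constraint excludes it (`IsShadowClosed.mConvex_of_isSolution`).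
Exchanging `A` and `B` treats the complement.

**Order structure of the solutions.** The type of a vertex is the pair of its neighborhoods in `A`
and in `B`, and types are ordered by growing towards `A` and shrinking towards `B` (`TypeLE`). Two
nonadjacent nontrivial vertices of `∂R` have the same type, because a vertex distinguishing them
prolongs an induced path through the edges between `A` and `B` to an implication constraint that
contradicts nontriviality (`IsShadowClosed.typeLE_of_not_adj`). The implication constraints
between nontrivial `x, y ∈ ∂R` are thus exactly `y → x` whenever the type of `x` is not below that
of `y`. Two cases remain. If all types agree, there are no implications and the classes can be
chosen independently. Otherwise the nontrivial vertices of `∂R` form a clique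
(`IsShadowClosed.adj_of_not_typeLE`), all constraints between them are implications, and making
all of them true is a solution. In both cases, orienting the cells by a suitable reference
solution (`IsShadowClosed.exists_reference`) turns the solutions into the sets of classes that are
closed under a relation `Above` on the classes (`IsShadowClosed.isSolution_iff`). By transitivity
of the order of types this relation is a strict weak order; its levels are the blocks, and a
closed set of classes consists of all levels before some level together with a part of that level.

**VC-dimension.** In a cell decomposition one vertex from each class of a block gives a shattered
set. Conversely, the vertices of a shattered set are nontrivial, no two of them belong to one
class, and no two belong to different blocks, since the later of two classes in different blocks
is never chosen without the earlier one (`CellPartition.exists_card_le_of_shatters`).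
-/

namespace Monophonic

variable {V : Type*} {G : SimpleGraph V}

/-! ### Induced paths -/

theorem isInducedPath_nil (u : V) : IsInducedPath G (SimpleGraph.Walk.nil : G.Walk u u) := by
  refine ⟨SimpleGraph.Walk.IsPath.nil, ?_⟩
  rw [SimpleGraph.Walk.isChordless_iff_forall_mem_edges]
  intro x y hx hy h
  simp only [SimpleGraph.Walk.support_nil, List.mem_singleton] at hx hy
  subst hx hy
  exact (G.irrefl h).elim

theorem isInducedPath_cons_iff {u v w : V} (h : G.Adj u v) (p : G.Walk v w) :
    IsInducedPath G (SimpleGraph.Walk.cons h p) ↔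
      IsInducedPath G p ∧ u ∉ p.support ∧ ∀ x ∈ p.support, G.Adj u x → x = v := by
  simp only [IsInducedPath, SimpleGraph.Walk.cons_isPath_iff,
    SimpleGraph.Walk.isChordless_iff_forall_mem_edges, SimpleGraph.Walk.support_cons,
    SimpleGraph.Walk.edges_cons, List.mem_cons]
  constructor
  · rintro ⟨⟨hp, hu⟩, hc⟩
    refine ⟨⟨hp, fun x y hx hy hxy => ?_⟩, hu, fun x hx hux => ?_⟩
    · rcases hc (Or.inr hx) (Or.inr hy) hxy with h1 | h1
      · rw [Sym2.eq_iff] at h1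
        rcases h1 with ⟨rfl, rfl⟩ | ⟨rfl, rfl⟩ <;> contradiction
      · exact h1
    · rcases hc (Or.inl rfl) (Or.inr hx) hux with h1 | h1
      · rw [Sym2.eq_iff] at h1
        rcases h1 with ⟨_, rfl⟩ | ⟨rfl, rfl⟩
        · rfl
        · exact (G.irrefl hux).elim
      · exact absurd (SimpleGraph.Walk.fst_mem_support_of_mem_edges _ h1) hu
  · rintro ⟨⟨hp, hc⟩, hu, hn⟩
    refine ⟨⟨hp, hu⟩, fun x y hx hy hxy => ?_⟩
    rcases hx with rfl | hx <;> rcases hy with rfl | hy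
    · exact (G.irrefl hxy).elim
    · left; rw [hn y hy hxy]
    · left; rw [hn x hx hxy.symm, Sym2.eq_swap]
    · exact Or.inr (hc hx hy hxy)

theorem IsInducedPath.reverse {u v : V} {p : G.Walk u v} (hp : IsInducedPath G p) :
    IsInducedPath G p.reverse := by
  refine ⟨hp.1.reverse, ?_⟩
  have h := hp.2
  rw [SimpleGraph.Walk.isChordless_iff_forall_mem_edges] at h ⊢
  simpa using h

theorem IsInducedPath.of_append_right {u v w : V} {p : G.Walk u v} {q : G.Walk v w}
    (h : IsInducedPath G (p.append q)) : IsInducedPath G q := by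
  induction p with
  | nil => simpa using h
  | cons e p ih =>
    rw [SimpleGraph.Walk.cons_append, isInducedPath_cons_iff] at h
    exact ih h.1

theorem IsInducedPath.of_append_left {u v w : V} {p : G.Walk u v} {q : G.Walk v w}
    (h : IsInducedPath G (p.append q)) : IsInducedPath G p := by
  have h1 := h.reverse
  rw [SimpleGraph.Walk.reverse_append] at h1
  simpa using h1.of_append_right.reverse

/-- If `u` is adjacent to some vertex of an induced path, then entering the path at its last
neighbor of `u` gives an induced path from `u`. -/
theorem IsInducedPath.exists_extend {u v w : V} (q : G.Walk v w) (hq : IsInducedPath G q)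
    (hu : u ∉ q.support) (hx : ∃ x ∈ q.support, G.Adj u x) :
    ∃ p : G.Walk u w, IsInducedPath G p ∧ ∀ z ∈ p.support, z = u ∨ z ∈ q.support := by
  induction q with
  | nil =>
    obtain ⟨x, hx, hux⟩ := hx
    simp only [SimpleGraph.Walk.support_nil, List.mem_singleton] at hx hu
    subst hx
    refine ⟨.cons hux .nil, ?_, by simp⟩
    rw [isInducedPath_cons_iff]
    exact ⟨isInducedPath_nil _, by simpa using hu, by simp⟩
  | cons e q ih =>
    have hq' := (isInducedPath_cons_iff _ _).1 hq
    simp only [SimpleGraph.Walk.support_cons, List.mem_cons, not_or] at hu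
    by_cases h : ∃ x ∈ q.support, G.Adj u x
    · obtain ⟨p, hp, hs⟩ := ih hq'.1 hu.2 h
      refine ⟨p, hp, fun z hz => ?_⟩
      rcases hs z hz with h | h
      · exact Or.inl h
      · exact Or.inr (by simp [h])
    · push Not at h
      obtain ⟨x, hx, hux⟩ := hx
      rw [SimpleGraph.Walk.support_cons, List.mem_cons] at hx
      rcases hx with rfl | hx
      · refine ⟨.cons hux (.cons e q), ?_, by simp⟩
        rw [isInducedPath_cons_iff]
        refine ⟨hq, by simpa using hu, fun y hy huy => ?_⟩
        rw [SimpleGraph.Walk.support_cons, List.mem_cons] at hy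
        rcases hy with rfl | hy
        · rfl
        · exact (h y hy huy).elim
      · exact (h x hx hux).elim

/-- Every walk can be shortcut to an induced path through some of its vertices. -/
theorem exists_isInducedPath_of_walk {u w : V} (q : G.Walk u w) :
    ∃ p : G.Walk u w, IsInducedPath G p ∧ ∀ z ∈ p.support, z ∈ q.support := by
  classical
  induction q with
  | nil => exact ⟨.nil, isInducedPath_nil _, by simp⟩
  | @cons u v w e q ih =>
    obtain ⟨p, hp, hs⟩ := ih
    by_cases hu : u ∈ p.support
    · refine ⟨p.dropUntil u hu, ?_, fun z hz => ?_⟩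
      · refine IsInducedPath.of_append_right (p := p.takeUntil u hu) ?_
        rwa [SimpleGraph.Walk.take_spec]
      · have := hs z (p.support_dropUntil_subset_support hu hz)
        simp [this]
    · obtain ⟨p', hp', hs'⟩ := hp.exists_extend p hu ⟨v, p.start_mem_support, e⟩
      refine ⟨p', hp', fun z hz => ?_⟩
      rcases hs' z hz with rfl | h
      · simp
      · simp [hs z h]

/-- A set that is not m-convex is left by an induced path all of whose inner vertices are
outside the set. -/
theorem exists_escaping_path {S : Set V} (h : ¬ MConvex G S) :
    ∃ s ∈ S, ∃ t ∈ S, ∃ p : G.Walk s t, IsInducedPath G p ∧ (∃ z ∈ p.support, z ∉ S) ∧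
      ∀ z ∈ p.support, z ∈ S → z = s ∨ z = t := by
  classical
  have key : ∀ n : ℕ, ∀ s ∈ S, ∀ t ∈ S, ∀ p : G.Walk s t, p.length = n → IsInducedPath G p →
      (∃ z ∈ p.support, z ∉ S) →
      ∃ s ∈ S, ∃ t ∈ S, ∃ p : G.Walk s t, IsInducedPath G p ∧ (∃ z ∈ p.support, z ∉ S) ∧
        ∀ z ∈ p.support, z ∈ S → z = s ∨ z = t := by
    intro n
    induction n using Nat.strong_induction_on with
    | _ n ih =>
      intro s hs t ht p hn hp hz
      by_cases hall : ∀ z ∈ p.support, z ∈ S → z = s ∨ z = t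
      · exact ⟨s, hs, t, ht, p, hp, hz, hall⟩
      · push Not at hall
        obtain ⟨x, hx, hxS, hxs, hxt⟩ := hall
        obtain ⟨z, hz, hzS⟩ := hz
        have hsp := p.take_spec hx
        have hz' := hz
        rw [← hsp, SimpleGraph.Walk.mem_support_append_iff] at hz'
        have hp' := hp
        rw [← hsp] at hp'
        rcases hz' with hz' | hz'
        · exact ih _ (hn ▸ SimpleGraph.Walk.length_takeUntil_lt_length hx hxt) s hs x hxS _ rfl
            hp'.of_append_left ⟨z, hz', hzS⟩
        · exact ih _ (hn ▸ SimpleGraph.Walk.length_dropUntil_lt_length hx hxs) x hxS t ht _ rfl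
            hp'.of_append_right ⟨z, hz', hzS⟩
  simp only [MConvex, mInterval, Set.subset_def, Set.mem_ofPred_eq, not_forall] at h
  obtain ⟨s, hs, t, ht, z, ⟨p, hp, hz⟩, hzS⟩ := h
  exact key _ s hs t ht p rfl hp ⟨z, hz, hzS⟩

theorem not_adj_of_escaping {S : Set V} {s t : V} {p : G.Walk s t} (hp : IsInducedPath G p)
    (hz : ∃ z ∈ p.support, z ∉ S) (hs : s ∈ S) (ht : t ∈ S) : s ≠ t ∧ ¬ G.Adj s t := by
  cases p with
  | nil =>
    obtain ⟨z, hz, hzS⟩ := hz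
    simp only [SimpleGraph.Walk.support_nil, List.mem_singleton] at hz
    exact (hzS (hz ▸ hs)).elim
  | @cons _ y _ e q =>
    have h := (isInducedPath_cons_iff _ _).1 hp
    refine ⟨fun hst => h.2.1 (hst ▸ q.end_mem_support), fun hst => ?_⟩
    have hty := h.2.2 t q.end_mem_support hst
    subst hty
    have hq : q = .nil := (SimpleGraph.Walk.isPath_iff_nil.1 h.1.1).eq_nil
    subst hq
    obtain ⟨z, hz, hzS⟩ := hz
    simp only [SimpleGraph.Walk.support_cons, SimpleGraph.Walk.support_nil, List.mem_cons,
      List.not_mem_nil, or_false] at hz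
    rcases hz with rfl | rfl <;> contradiction

/-- The second vertex of an escaping path is outside the set. -/
theorem exists_adj_of_escaping {S : Set V} {s t : V} {p : G.Walk s t} (hp : IsInducedPath G p)
    (hz : ∃ z ∈ p.support, z ∉ S) (hs : s ∈ S) (ht : t ∈ S)
    (hall : ∀ z ∈ p.support, z ∈ S → z = s ∨ z = t) :
    ∃ y, ∃ e : G.Adj s y, ∃ q : G.Walk y t, p = .cons e q ∧ y ∉ S := by
  obtain ⟨hne, hna⟩ := not_adj_of_escaping hp hz hs ht
  cases p with
  | nil => exact (hne rfl).elim
  | @cons _ y _ e q =>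
    refine ⟨y, e, q, rfl, fun hy => ?_⟩
    rcases hall y (by simp) hy with rfl | rfl
    · exact G.irrefl e
    · exact hna e

/-! ### Monophonic hulls -/

theorem subset_mHull (S : Set V) : S ⊆ mHull G S := fun _ hx _ hT => hT.2 hx

theorem mHull_subset {S T : Set V} (hT : MConvex G T) (h : S ⊆ T) : mHull G S ⊆ T :=
  fun _ hx => hx T ⟨hT, h⟩

theorem mConvex_mHull (S : Set V) : MConvex G (mHull G S) := by
  intro u hu v hv z hz T hT
  exact hT.1 u (hu T hT) v (hv T hT) hz

theorem mem_mHull_of_isInducedPath {S : Set V} {u v z : V} {p : G.Walk u v}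
    (hp : IsInducedPath G p) (hu : u ∈ S) (hv : v ∈ S) (hz : z ∈ p.support) : z ∈ mHull G S :=
  mConvex_mHull S u (subset_mHull S hu) v (subset_mHull S hv) ⟨p, hp, hz⟩

theorem subset_shadow (A B : Set V) : A ⊆ shadow G A B :=
  fun x hx => ⟨x, subset_mHull _ (by simp), hx⟩

theorem mem_of_mem_mHull_pair {H : Set V} (hH : MConvex G H) {x u w : V} (hx : x ∈ H)
    (hu : u ∈ H) (hw : w ∈ mHull G {x, u}) : w ∈ H :=
  mHull_subset hH (by rintro z (rfl | rfl) <;> assumption) hw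

/-- Two nonadjacent vertices with a common neighbor outside an m-convex set do not both belong to
that set. -/
theorem adj_of_mem_of_mem {H : Set V} (hH : MConvex G H) {x y v : V} (hx : x ∈ H) (hy : y ∈ H)
    (hv : v ∉ H) (hne : x ≠ y) (hxv : G.Adj x v) (hyv : G.Adj y v) : G.Adj x y := by
  by_contra hna
  refine hv (hH x hx y hy ⟨.cons hxv (.cons hyv.symm .nil), ?_, by simp⟩)
  have := hxv.ne
  have := hyv.ne
  simp only [isInducedPath_cons_iff, isInducedPath_nil, SimpleGraph.Walk.support_cons,
    SimpleGraph.Walk.support_nil, List.mem_cons, List.not_mem_nil, or_false]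
  grind

/-! ### The shadow closure -/

theorem shadowIter_swap (A B : Set V) (i : ℕ) :
    shadowIter G B A i = (shadowIter G A B i).swap := by
  induction i with
  | zero => rfl
  | succ i ih => simp [shadowIter, ih]

theorem shadowClosure_swap (A B : Set V) :
    shadowClosure G B A = (shadowClosure G A B).swap := by
  simp [shadowClosure, shadowIter_swap A B]

theorem shadowIter_mono (A B : Set V) : Monotone fun i => (shadowIter G A B i).1 := by
  refine monotone_nat_of_le_succ fun i => ?_
  exact (subset_shadow _ _).trans (subset_mHull _)

theorem mConvex_shadowClosure_fst {A B : Set V} (hA : MConvex G A) :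
    MConvex G (shadowClosure G A B).1 := by
  have h : ∀ i, MConvex G (shadowIter G A B i).1 := by
    rintro (_ | i)
    · exact hA
    · exact mConvex_mHull _
  intro u hu v hv
  simp only [shadowClosure, Set.mem_iUnion] at hu hv
  obtain ⟨i, hi⟩ := hu
  obtain ⟨j, hj⟩ := hv
  refine (h (max i j) u (shadowIter_mono A B (le_max_left i j) hi) v
    (shadowIter_mono A B (le_max_right i j) hj)).trans ?_
  exact Set.subset_iUnion (fun i => (shadowIter G A B i).1) _

/-- As `V` is finite, the second iterates stabilize, so a shadow with respect to their union is
absorbed by the next first iterate. -/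
theorem shadow_shadowClosure_subset [Finite V] (A B : Set V) :
    shadow G (shadowClosure G A B).1 (shadowClosure G A B).2 ⊆ (shadowClosure G A B).1 := by
  have hB : Monotone fun i => (shadowIter G A B i).2 := by
    have := shadowIter_mono (G := G) B A
    simpa [shadowIter_swap A B] using this
  obtain ⟨m, hm⟩ := WellFoundedGT.monotone_chain_condition
    (⟨fun i => (shadowIter G A B i).2, hB⟩ : ℕ →o Set V)
  have hB' : ∀ i, m ≤ i → (shadowClosure G A B).2 = (shadowIter G A B i).2 := by
    intro i hi
    refine subset_antisymm (Set.iUnion_subset fun j => ?_)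
      (Set.subset_iUnion (fun i => (shadowIter G A B i).2) i)
    refine (hB (le_max_left j i)).trans ?_
    have h1 := hm i hi
    have h2 := hm (max j i) (hi.trans (le_max_right _ _))
    simp only [OrderHom.coe_mk] at h1 h2
    exact (h2.symm.trans h1).le
  rintro x ⟨y, hy, hyA⟩
  simp only [shadowClosure, Set.mem_iUnion] at hyA
  obtain ⟨i, hi⟩ := hyA
  have hi' := shadowIter_mono A B (le_max_left i m) hi
  rw [hB' (max i m) (le_max_right _ _)] at hy
  refine Set.mem_iUnion.2 ⟨max i m + 1, ?_⟩
  exact subset_mHull _ ⟨y, hy, hi'⟩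

/-- A halfspace separating two sets contains the first side of their shadow closure and avoids
the second. -/
theorem shadowClosure_subset_of_isMHalfspace {A B H : Set V} (hH : IsMHalfspace G H) (hA : A ⊆ H)
    (hB : B ⊆ Hᶜ) : (shadowClosure G A B).1 ⊆ H ∧ (shadowClosure G A B).2 ⊆ Hᶜ := by
  have aux : ∀ {S T K : Set V}, MConvex G K → MConvex G Kᶜ → S ⊆ K → T ⊆ Kᶜ →
      mHull G (shadow G S T) ⊆ K := by
    intro S T K hK hK' hS hT
    refine mHull_subset hK ?_
    rintro x ⟨y, hy, hyS⟩
    by_contra hx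
    exact mHull_subset hK' (Set.union_subset hT (Set.singleton_subset_iff.2 hx)) hy (hS hyS)
  have h : ∀ i, (shadowIter G A B i).1 ⊆ H ∧ (shadowIter G A B i).2 ⊆ Hᶜ := by
    intro i
    induction i with
    | zero => exact ⟨hA, hB⟩
    | succ i ih =>
      refine ⟨aux hH.1 hH.2 ih.1 ih.2, aux hH.2 ?_ ih.2 ?_⟩
      · rw [compl_compl]; exact hH.1
      · rw [compl_compl]; exact ih.1
  exact ⟨Set.iUnion_subset fun i => (h i).1, Set.iUnion_subset fun i => (h i).2⟩

theorem mConvex_singleton (a : V) : MConvex G {a} := by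
  rintro u rfl v rfl z ⟨p, hp, hz⟩
  have : p = .nil := (SimpleGraph.Walk.isPath_iff_nil.1 hp.1).eq_nil
  subst this
  simpa using hz

/-! ### Shadow-closed pairs -/

/-- A pair of disjoint m-convex sets of a connected graph that are joined by an edge and are
closed under taking shadows with respect to each other. -/
structure IsShadowClosed (G : SimpleGraph V) (A B : Set V) : Prop where
  connected : G.Connected
  convex_left : MConvex G A
  convex_right : MConvex G B
  disjoint : Disjoint A B
  shadow_left : shadow G A B ⊆ A
  shadow_right : shadow G B A ⊆ B
  exists_adj : ∃ u ∈ A, ∃ v ∈ B, G.Adj u v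

theorem residue_comm (A B : Set V) : residue B A = residue A B := by
  rw [residue, residue, Set.union_comm]

theorem notMem_left_of_mem_residue {A B : Set V} {x : V} (hx : x ∈ residue A B) : x ∉ A :=
  fun h => hx (Or.inl h)

theorem notMem_right_of_mem_residue {A B : Set V} {x : V} (hx : x ∈ residue A B) : x ∉ B :=
  fun h => hx (Or.inr h)

theorem separatorSet_comm (A B : Set V) (x : V) :
    separatorSet G B A x = separatorSet G A B x := by
  ext w
  simp only [separatorSet, residue_comm A B, Set.mem_ofPred_eq]
  constructor <;>
  · rintro ⟨hw, u, hu, v, hv, e, h1, h2⟩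
    exact ⟨hw, v, hv, u, hu, e.symm, h2, h1⟩

theorem IsSolution.swap {A B : Set V} {α : V → Bool} (h : IsSolution G A B α) :
    IsSolution G B A fun x => !α x where
  equality x hx w hw := by
    rw [residue_comm] at hx
    rw [separatorSet_comm] at hw
    rw [h.equality x hx w hw]
  difference x hx y hy hne hna := by
    rw [residue_comm] at hx hy
    simpa using h.difference x hx y hy hne hna
  impliesA x hx y hy hi := by
    rw [residue_comm] at hx hy
    simpa using h.impliesB x hx y hy hi
  impliesB x hx y hy hi := by
    rw [residue_comm] at hx hy
    simpa using h.impliesA x hx y hy hi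

/-- A walk from `x` that stays in the interior of `R` up to its end `w` and then steps to a vertex
`t` outside `R` puts `w` into the hull of `{x, t}`: it can be shortcut to an induced path, and the
only vertex from which this path can step to `t` is `w`. -/
theorem mem_mHull_pair {R : Set V} {x w t : V} (hx : x ∈ R) (p : G.Walk x w)
    (hp : ∀ z ∈ p.support, z ≠ w → z ∈ R ∧ z ∉ boundary G R) (ht : t ∉ R) (hwt : G.Adj w t) :
    w ∈ mHull G {x, t} := by
  obtain ⟨q, hq, hs⟩ := exists_isInducedPath_of_walk (p.concat hwt)
  by_cases hw : w ∈ q.support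
  · exact mem_mHull_of_isInducedPath hq (by simp) (by simp) hw
  · exfalso
    have hs' : ∀ z ∈ q.reverse.support, z = t ∨ z ∈ R ∧ z ∉ boundary G R := by
      intro z hz
      rw [SimpleGraph.Walk.support_reverse, List.mem_reverse] at hz
      have := hs z hz
      simp only [SimpleGraph.Walk.support_concat, List.mem_append,
        List.mem_cons, List.not_mem_nil, or_false] at this
      rcases this with h | rfl
      · exact Or.inr (hp z h (by rintro rfl; exact hw hz))
      · exact Or.inl rfl
    generalize q.reverse = r at hs'
    cases r with
    | nil => exact ht hx
    | @cons _ y _ e r =>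
      rcases hs' y (by simp) with rfl | h
      · exact G.irrefl e
      · exact h.2 ⟨h.1, t, ht, e.symm⟩

/-- A walk that leaves `R` reaches the boundary of `R` through interior vertices. -/
theorem exists_walk_boundary {R : Set V} {x u : V} (q : G.Walk x u) (hx : x ∈ R) (hu : u ∉ R) :
    ∃ w ∈ boundary G R, ∃ p : G.Walk x w,
      ∀ z ∈ p.support, z ≠ w → z ∈ R ∧ z ∉ boundary G R := by
  induction q with
  | nil => exact (hu hx).elim
  | @cons x y u e q ih =>
    by_cases hxb : x ∈ boundary G R
    · exact ⟨x, hxb, .nil, by simp⟩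
    · have hy : y ∈ R := by
        by_contra hy
        exact hxb ⟨hx, y, hy, e⟩
      obtain ⟨w, hw, p, hp⟩ := ih hy hu
      refine ⟨w, hw, .cons e p, fun z hz hzw => ?_⟩
      rw [SimpleGraph.Walk.support_cons, List.mem_cons] at hz
      rcases hz with rfl | hz
      · exact ⟨hx, hxb⟩
      · exact hp z hz hzw

namespace IsShadowClosed

variable {A B : Set V}

protected theorem symm (h : IsShadowClosed G A B) : IsShadowClosed G B A where
  connected := h.connected
  convex_left := h.convex_right
  convex_right := h.convex_left
  disjoint := h.disjoint.symm
  shadow_left := h.shadow_right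
  shadow_right := h.shadow_left
  exists_adj := by
    obtain ⟨u, hu, v, hv, e⟩ := h.exists_adj
    exact ⟨v, hv, u, hu, e.symm⟩

/-- A vertex `x` of the residue with a neighbor in `A` is adjacent to every vertex `v` of `B` with
a neighbor in `A`. Otherwise an induced path from `x` to `v` through `A`, which is connected,
would put `x` into the shadow `A / B ⊆ A`. -/
theorem adj_of_adj_left (h : IsShadowClosed G A B) {x z v : V} (hx : x ∈ residue A B)
    (hz : z ∈ A) (hxz : G.Adj x z) (hv : v ∈ relBoundary G B A) : G.Adj x v := by
  obtain ⟨hvB, u, hu, hvu⟩ := hv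
  obtain ⟨p₀⟩ := h.connected.preconnected z u
  obtain ⟨p, hp, -⟩ := exists_isInducedPath_of_walk p₀
  obtain ⟨q, hq, hs⟩ := exists_isInducedPath_of_walk (.cons hxz (p.concat hvu.symm))
  cases q with
  | nil => exact (notMem_right_of_mem_residue hx hvB).elim
  | @cons _ y _ e q =>
    have hy := hs y (by simp)
    simp only [SimpleGraph.Walk.support_cons, SimpleGraph.Walk.support_concat, List.mem_cons,
      List.mem_append, List.not_mem_nil, or_false] at hy
    rcases hy with rfl | hy | rfl
    · exact (G.irrefl e).elim
    · refine (notMem_left_of_mem_residue hx (h.shadow_left ⟨y, ?_, ?_⟩)).elim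
      · exact mem_mHull_of_isInducedPath hq (by simp) (by simp [hvB]) (by simp)
      · exact h.convex_left z hz u hu ⟨p, hp, hy⟩
    · exact e

/-- Each boundary vertex of the residue is adjacent to every vertex of `B` with a neighbor
in `A`. -/
theorem adj_relBoundary_right (h : IsShadowClosed G A B) {x v : V}
    (hx : x ∈ boundary G (residue A B)) (hv : v ∈ relBoundary G B A) : G.Adj x v := by
  obtain ⟨hxR, z, hz, hxz⟩ := hx
  have hz' : z ∈ A ∪ B := Set.notMem_compl_iff.1 hz
  rcases hz' with hzA | hzB
  · exact h.adj_of_adj_left hxR hzA hxz hv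
  · obtain ⟨hvB, u, hu, hvu⟩ := hv
    have hxu : G.Adj x u := h.symm.adj_of_adj_left (by rwa [residue_comm]) hzB hxz
      ⟨hu, v, hvB, hvu.symm⟩
    exact h.adj_of_adj_left hxR hu hxu ⟨hvB, u, hu, hvu⟩

theorem adj_relBoundary_left (h : IsShadowClosed G A B) {x u : V}
    (hx : x ∈ boundary G (residue A B)) (hu : u ∈ relBoundary G A B) : G.Adj x u :=
  h.symm.adj_relBoundary_right (by rwa [residue_comm]) hu

theorem mem_separatorSet (h : IsShadowClosed G A B) {x w : V} (hx : x ∈ residue A B)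
    (hw : w ∈ boundary G (residue A B)) (p : G.Walk x w)
    (hp : ∀ z ∈ p.support, z ≠ w → z ∈ residue A B ∧ z ∉ boundary G (residue A B)) :
    w ∈ separatorSet G A B x := by
  obtain ⟨u, hu, v, hv, e⟩ := h.exists_adj
  have hu' : u ∈ relBoundary G A B := ⟨hu, v, hv, e⟩
  have hv' : v ∈ relBoundary G B A := ⟨hv, u, hu, e.symm⟩
  exact ⟨hw, u, hu', v, hv', e,
    mem_mHull_pair hx p hp (fun h => notMem_left_of_mem_residue h hu)
      (h.adj_relBoundary_left hw hu'),
    mem_mHull_pair hx p hp (fun h => notMem_right_of_mem_residue h hv)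
      (h.adj_relBoundary_right hw hv')⟩

theorem exists_walk_boundary_residue (h : IsShadowClosed G A B) {x : V} (hx : x ∈ residue A B) :
    ∃ w ∈ boundary G (residue A B), ∃ p : G.Walk x w,
      ∀ z ∈ p.support, z ≠ w → z ∈ residue A B ∧ z ∉ boundary G (residue A B) := by
  obtain ⟨u, hu, -⟩ := h.exists_adj
  obtain ⟨q⟩ := h.connected.preconnected x u
  exact exists_walk_boundary q hx fun h => notMem_left_of_mem_residue h hu

theorem exists_mem_separatorSet (h : IsShadowClosed G A B) {x : V} (hx : x ∈ residue A B) :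
    ∃ w, w ∈ separatorSet G A B x := by
  obtain ⟨w, hw, p, hp⟩ := h.exists_walk_boundary_residue hx
  exact ⟨w, h.mem_separatorSet hx hw p hp⟩

/-- A solution takes the same value at an interior vertex of the residue and at each of its
neighbors. -/
theorem eq_of_adj (h : IsShadowClosed G A B) {α : V → Bool} (hα : IsSolution G A B α) {x y : V}
    (hx : x ∈ residue A B) (hxb : x ∉ boundary G (residue A B)) (hxy : G.Adj x y) :
    α x = α y := by
  have hy : y ∈ residue A B := by
    by_contra hy
    exact hxb ⟨hx, y, hy, hxy⟩
  obtain ⟨w, hw, p, hp⟩ := h.exists_walk_boundary_residue hy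
  rw [hα.equality y hy w (h.mem_separatorSet hy hw p hp)]
  refine hα.equality x hx w (h.mem_separatorSet hx hw (.cons hxy p) fun z hz hzw => ?_)
  rw [SimpleGraph.Walk.support_cons, List.mem_cons] at hz
  rcases hz with rfl | hz
  · exact ⟨hx, hxb⟩
  · exact hp z hz hzw

/-! ### Halfspaces are the solutions of the formula -/

variable {α : V → Bool}

/-- By the equality constraints, the value of a solution changes only between boundary vertices
of the residue. -/
theorem mem_boundary_of_adj (h : IsShadowClosed G A B) (hα : IsSolution G A B α) {t y : V}
    (ht : t ∈ residue A B ∧ α t = true) (hty : G.Adj t y)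
    (hy : y ∉ A ∪ {x | x ∈ residue A B ∧ α x = true}) : t ∈ boundary G (residue A B) := by
  by_contra hb
  have hyR : y ∈ residue A B := by
    by_contra hyR
    exact hb ⟨ht.1, y, hyR, hty⟩
  exact hy (Or.inr ⟨hyR, (h.eq_of_adj hα ht.1 hb hty) ▸ ht.2⟩)

/-- No path with all its inner vertices outside the set of a solution joins a vertex `s` of `A` to
a vertex `t` of that set in the residue. The vertex `y` following `s` would be on the boundary of
the residue, and the implication constraint given by the reversed path forces `y` into the set. -/
theorem false_of_escaping (h : IsShadowClosed G A B) (hα : IsSolution G A B α) {s t : V}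
    (hs : s ∈ A) (ht : t ∈ residue A B ∧ α t = true) (p : G.Walk s t) (hp : IsInducedPath G p)
    (hz : ∃ z ∈ p.support, z ∉ A ∪ {x | x ∈ residue A B ∧ α x = true})
    (hall : ∀ z ∈ p.support, z ∈ A ∪ {x | x ∈ residue A B ∧ α x = true} → z = s ∨ z = t) :
    False := by
  have hr := hp.reverse
  obtain ⟨x, e', q', -, hx⟩ := exists_adj_of_escaping hr (by simpa using hz)
    (Or.inr ht) (Or.inl hs) (fun z hz hzS => (hall z (by simpa using hz) hzS).symm)
  have htb := h.mem_boundary_of_adj hα ht e' hx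
  obtain ⟨y, e, q, rfl, hy⟩ := exists_adj_of_escaping hp hz (Or.inl hs) (Or.inr ht) hall
  have hyR : y ∈ residue A B := by
    rintro (hyA | hyB)
    · exact hy (Or.inl hyA)
    · refine notMem_right_of_mem_residue ht.1 (h.shadow_right ⟨y, ?_, hyB⟩)
      exact mem_mHull_of_isInducedPath hp (by simp [hs]) (by simp) (by simp)
  have hyb : y ∈ boundary G (residue A B) :=
    ⟨hyR, s, fun h => notMem_left_of_mem_residue h hs, e.symm⟩
  refine hy (Or.inr ⟨hyR, hα.impliesA t htb y hyb ⟨s, hs, q.reverse, e.symm, ?_⟩ ht.2⟩)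
  simpa [SimpleGraph.Walk.concat_eq_append] using hr

theorem mConvex_of_isSolution (h : IsShadowClosed G A B) (hα : IsSolution G A B α) :
    MConvex G (A ∪ {x | x ∈ residue A B ∧ α x = true}) := by
  by_contra hc
  obtain ⟨s, hs, t, ht, p, hp, hz, hall⟩ := exists_escaping_path hc
  obtain ⟨hne, hna⟩ := not_adj_of_escaping hp hz hs ht
  have hzr : ∃ z ∈ p.reverse.support, z ∉ A ∪ {x | x ∈ residue A B ∧ α x = true} := by
    simpa using hz
  have hallr : ∀ z ∈ p.reverse.support, z ∈ A ∪ {x | x ∈ residue A B ∧ α x = true} →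
      z = t ∨ z = s := fun z hz hzS => (hall z (by simpa using hz) hzS).symm
  obtain ⟨y, e, q, -, hy⟩ := exists_adj_of_escaping hp hz hs ht hall
  obtain ⟨y', e', q', -, hy'⟩ := exists_adj_of_escaping hp.reverse hzr ht hs hallr
  rcases hs with hs | hs <;> rcases ht with ht | ht
  · obtain ⟨z, hz, hzS⟩ := hz
    exact hzS (Or.inl (h.convex_left s hs t ht ⟨p, hp, hz⟩))
  · exact h.false_of_escaping hα hs ht p hp hz hall
  · exact h.false_of_escaping hα ht hs p.reverse hp.reverse hzr hallr
  · refine hα.difference s (h.mem_boundary_of_adj hα hs e hy) t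
      (h.mem_boundary_of_adj hα ht e' hy') hne hna ?_
    rw [hs.2, ht.2]

theorem compl_eq (h : IsShadowClosed G A B) (α : V → Bool) :
    (A ∪ {x | x ∈ residue A B ∧ α x = true})ᶜ =
      B ∪ {x | x ∈ residue B A ∧ (!α x) = true} := by
  ext x
  have hd : x ∈ A → x ∉ B := fun h1 => Set.disjoint_left.1 h.disjoint h1
  simp only [residue, Set.mem_compl_iff, Set.mem_union, Set.mem_ofPred_eq, Bool.not_eq_true']
  cases α x <;> simp <;> tauto

theorem isMHalfspace_of_isSolution (h : IsShadowClosed G A B) (hα : IsSolution G A B α) :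
    IsMHalfspace G (A ∪ {x | x ∈ residue A B ∧ α x = true}) := by
  refine ⟨h.mConvex_of_isSolution hα, ?_⟩
  rw [h.compl_eq]
  exact h.symm.mConvex_of_isSolution hα.swap

/-- The constraints of the formula are necessary: they hold for the indicator of a halfspace. -/
theorem isSolution_of_isMHalfspace (h : IsShadowClosed G A B) {H : Set V} (hH : IsMHalfspace G H)
    (hA : A ⊆ H) (hB : B ⊆ Hᶜ) (hα : ∀ x ∈ residue A B, (α x = true ↔ x ∈ H)) :
    IsSolution G A B α := by
  have hα' : ∀ x ∈ residue A B, (α x = false ↔ x ∈ Hᶜ) := by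
    intro x hx
    rw [Set.mem_compl_iff, ← hα x hx, Bool.not_eq_true]
  obtain ⟨u, hu, v, hv, e⟩ := h.exists_adj
  refine ⟨?_, ?_, ?_, ?_⟩
  · rintro x hx w ⟨hw, u, hu, v, hv, -, hwu, hwv⟩
    cases hax : α x
    · exact ((hα' w hw.1).2 (mem_of_mem_mHull_pair hH.2 ((hα' x hx).1 hax) (hB hv.1) hwv)).symm
    · exact ((hα w hw.1).2 (mem_of_mem_mHull_pair hH.1 ((hα x hx).1 hax) (hA hu.1) hwu)).symm
  · intro x hx y hy hne hna hxy
    cases hax : α x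
    · refine hna (adj_of_mem_of_mem hH.2 ((hα' x hx.1).1 hax) ((hα' y hy.1).1 (hxy ▸ hax))
        (fun h => h (hA hu)) hne (h.adj_relBoundary_left hx ⟨hu, v, hv, e⟩)
        (h.adj_relBoundary_left hy ⟨hu, v, hv, e⟩))
    · refine hna (adj_of_mem_of_mem hH.1 ((hα x hx.1).1 hax) ((hα y hy.1).1 (hxy ▸ hax))
        (fun h => hB hv h) hne (h.adj_relBoundary_right hx ⟨hv, u, hu, e.symm⟩)
        (h.adj_relBoundary_right hy ⟨hv, u, hu, e.symm⟩))
  · rintro x hx y hy ⟨z, hz, q, e, hq⟩ hax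
    refine (hα y hy.1).2 (hH.1 x ((hα x hx.1).1 hax) z (hA hz) ⟨_, hq, ?_⟩)
    simp [SimpleGraph.Walk.support_concat]
  · rintro x hx y hy ⟨z, hz, q, e, hq⟩ hax
    refine (hα' y hy.1).2 (hH.2 x ((hα' x hx.1).1 hax) z (hB hz) ⟨_, hq, ?_⟩)
    simp [SimpleGraph.Walk.support_concat]

end IsShadowClosed

variable {a b : V}

theorem mem_halfspaces [Fintype V] {H : Finset V} :
    H ∈ halfspaces G a b ↔ IsMHalfspace G (H : Set V) ∧ a ∈ H ∧ b ∉ H := by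
  simp [halfspaces]

theorem mem_sideA (G : SimpleGraph V) (a b : V) : a ∈ sideA G a b :=
  Set.mem_iUnion.2 ⟨0, rfl⟩

theorem mem_sideB (G : SimpleGraph V) (a b : V) : b ∈ sideB G a b :=
  Set.mem_iUnion.2 ⟨0, rfl⟩

theorem side_subset [Fintype V] {H : Finset V} (hH : H ∈ halfspaces G a b) :
    sideA G a b ⊆ H ∧ sideB G a b ⊆ (H : Set V)ᶜ := by
  rw [mem_halfspaces] at hH
  exact shadowClosure_subset_of_isMHalfspace hH.1 (by simpa using hH.2.1) (by simpa using hH.2.2)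

theorem isShadowClosed_sides [Fintype V] (hG : G.Connected) (hab : G.Adj a b)
    (hne : (halfspaces G a b).Nonempty) : IsShadowClosed G (sideA G a b) (sideB G a b) := by
  obtain ⟨H, hH⟩ := hne
  have hs := side_subset hH
  have hswap : shadowClosure G {b} {a} = (shadowClosure G {a} {b}).swap := shadowClosure_swap _ _
  refine ⟨hG, mConvex_shadowClosure_fst (mConvex_singleton a), ?_, ?_,
    shadow_shadowClosure_subset _ _, ?_, a, mem_sideA G a b, b, mem_sideB G a b, hab⟩
  · have := mConvex_shadowClosure_fst (A := {b}) (B := {a}) (mConvex_singleton (G := G) b)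
    rwa [hswap] at this
  · exact Set.disjoint_left.2 fun x hx hx' => hs.2 hx' (hs.1 hx)
  · have := shadow_shadowClosure_subset (G := G) {b} {a}
    rwa [hswap] at this

/-- The halfspaces separating `a` from `b` are the sets described by the solutions of `Φ(ab)`. -/
theorem mem_halfspaces_iff_exists_solves [Fintype V] (hG : G.Connected) (hab : G.Adj a b)
    (hne : (halfspaces G a b).Nonempty) {H : Finset V} :
    H ∈ halfspaces G a b ↔ ∃ α, Solves G a b α ∧ (H : Set V) =
      sideA G a b ∪ {x | x ∈ residue (sideA G a b) (sideB G a b) ∧ α x = true} := by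
  classical
  have hP := isShadowClosed_sides hG hab hne
  constructor
  · intro hH
    have hs := side_subset hH
    rw [mem_halfspaces] at hH
    refine ⟨fun x => decide (x ∈ H), hP.isSolution_of_isMHalfspace hH.1 hs.1 hs.2 (by simp), ?_⟩
    ext x
    have h1 := @hs.1 x
    have h2 := @hs.2 x
    simp only [residue, Set.mem_compl_iff, Set.mem_union, Set.mem_ofPred_eq, decide_eq_true_eq,
      Finset.mem_coe] at h1 h2 ⊢
    tauto
  · rintro ⟨α, hα, hH⟩
    rw [mem_halfspaces, hH, ← Finset.mem_coe, ← Finset.mem_coe, hH]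
    refine ⟨hP.isMHalfspace_of_isSolution hα, Or.inl (mem_sideA G a b), ?_⟩
    rintro (h | h)
    · exact Set.disjoint_left.1 hP.disjoint h (mem_sideB G a b)
    · exact notMem_right_of_mem_residue h.1 (mem_sideB G a b)

/-! ### Types of boundary vertices -/

/-- The preorder on vertices comparing their neighborhoods in `A` and in `B`: towards `y` the
neighborhood in `A` grows and the neighborhood in `B` shrinks. -/
def TypeLE (G : SimpleGraph V) (A B : Set V) (x y : V) : Prop :=
  (∀ z ∈ A, G.Adj x z → G.Adj y z) ∧ ∀ z ∈ B, G.Adj y z → G.Adj x z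

theorem TypeLE.refl (A B : Set V) (x : V) : TypeLE G A B x x :=
  ⟨fun _ _ h => h, fun _ _ h => h⟩

theorem TypeLE.trans {A B : Set V} {x y z : V} (h : TypeLE G A B x y) (h' : TypeLE G A B y z) :
    TypeLE G A B x z :=
  ⟨fun w hw e => h'.1 w hw (h.1 w hw e), fun w hw e => h.2 w hw (h'.2 w hw e)⟩

/-- The vertices of the residue whose variable takes both values in the solutions of the formula
of the pair `(A, B)`. -/
def nontrivial (G : SimpleGraph V) (A B : Set V) : Set V :=
  {x | x ∈ residue A B ∧
    (∃ α, IsSolution G A B α ∧ α x = true) ∧ ∃ α, IsSolution G A B α ∧ α x = false}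

/-- Equivalence of variables: equal in all solutions or different in all solutions. -/
def Linked (G : SimpleGraph V) (A B : Set V) (x y : V) : Prop :=
  (∀ α, IsSolution G A B α → α x = α y) ∨ ∀ α, IsSolution G A B α → α x ≠ α y

/-- The strict order on the classes of nontrivial variables that produces the blocks: some
implication constraint forces a variable of the class of `x` to be true whenever a variable of
the other class, that of `y`, is true. -/
def Above (G : SimpleGraph V) (A B : Set V) (x y : V) : Prop :=
  ¬ Linked G A B x y ∧ ∃ x' ∈ nontrivial G A B ∩ boundary G (residue A B),
    ∃ y' ∈ nontrivial G A B ∩ boundary G (residue A B),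
      Linked G A B x x' ∧ Linked G A B y y' ∧ ¬ TypeLE G A B x' y'

section

variable {A B : Set V} {x y z : V} {α β : V → Bool}

theorem Linked.symm (h : Linked G A B x y) : Linked G A B y x :=
  h.imp (fun h α hα => (h α hα).symm) fun h α hα => (h α hα).symm

theorem Linked.trans (h : Linked G A B x y) (h' : Linked G A B y z) : Linked G A B x z := by
  rcases h with h | h <;> rcases h' with h' | h'
  · exact Or.inl fun α hα => (h α hα).trans (h' α hα)
  · exact Or.inr fun α hα => h α hα ▸ h' α hα
  · exact Or.inr fun α hα => h' α hα ▸ h α hα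
  · refine Or.inl fun α hα => ?_
    have h1 := h α hα
    have h2 := h' α hα
    cases hx : α x <;> cases hy : α y <;> cases hz : α z <;> simp_all

theorem Linked.eq_of_eq (h : Linked G A B x y) (hβ : IsSolution G A B β) (he : β x = β y)
    (hα : IsSolution G A B α) : α x = α y := by
  rcases h with h | h
  · exact h α hα
  · exact (h β hβ he).elim

theorem Linked.ne_of_ne (h : Linked G A B x y) (hβ : IsSolution G A B β) (he : β x ≠ β y)
    (hα : IsSolution G A B α) : α x ≠ α y := by
  rcases h with h | h
  · exact (he (h β hβ)).elim
  · exact h α hα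

theorem Linked.agree_iff (h : Linked G A B x y) (hβ : IsSolution G A B β)
    (hα : IsSolution G A B α) : α x = β x ↔ α y = β y := by
  rcases h with h | h
  · rw [h α hα, h β hβ]
  · have h1 := h α hα
    have h2 := h β hβ
    cases hx : α x <;> cases hy : α y <;> cases hx' : β x <;> cases hy' : β y <;> simp_all

theorem eq_of_notMem_nontrivial (hx : x ∈ residue A B) (hn : x ∉ nontrivial G A B)
    (hα : IsSolution G A B α) (hβ : IsSolution G A B β) : α x = β x := by
  by_contra hne
  refine hn ⟨hx, ?_⟩
  cases ha : α x <;> cases hb : β x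
  · simp_all
  · exact ⟨⟨β, hβ, hb⟩, α, hα, ha⟩
  · exact ⟨⟨α, hα, ha⟩, β, hβ, hb⟩
  · simp_all

theorem Linked.mem_nontrivial (h : Linked G A B x y) (hx : x ∈ nontrivial G A B)
    (hy : y ∈ residue A B) : y ∈ nontrivial G A B := by
  by_contra hn
  obtain ⟨-, ⟨α, hα, hax⟩, β, hβ, hbx⟩ := hx
  have h1 := eq_of_notMem_nontrivial hy hn hα hβ
  have h2 := (h.agree_iff hβ hα).2 h1
  simp_all

theorem nontrivial_comm : nontrivial G B A = nontrivial G A B := by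
  have aux : ∀ {A B : Set V}, nontrivial G A B ⊆ nontrivial G B A := by
    rintro A B x ⟨hx, ⟨α, hα, ha⟩, β, hβ, hb⟩
    exact ⟨by rwa [residue_comm], ⟨_, hβ.swap, by simpa using hb⟩, _, hα.swap, by simpa using ha⟩
  exact aux.antisymm aux

theorem implies_of_adj (hxy : G.Adj x y) (hz : z ∈ A) (hyz : G.Adj y z) (hxz : ¬ G.Adj x z)
    (hne : x ≠ z) : Implies G A x y := by
  refine ⟨z, hz, .cons hxy .nil, hyz, ?_⟩
  have := hxy.ne
  have := hyz.ne
  simp only [SimpleGraph.Walk.concat_cons, SimpleGraph.Walk.concat_nil, isInducedPath_cons_iff,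
    isInducedPath_nil, SimpleGraph.Walk.support_cons,
    SimpleGraph.Walk.support_nil, List.mem_cons, List.not_mem_nil, or_false]
  grind

/-- An implication constraint between distinct vertices is witnessed by a vertex adjacent to the
second vertex only. -/
theorem Implies.exists_adj (h : Implies G A x y) (hne : x ≠ y) :
    ∃ z ∈ A, G.Adj y z ∧ ¬ G.Adj x z := by
  obtain ⟨z, hz, q, e, hq⟩ := h
  refine ⟨z, hz, e, fun hxz => ?_⟩
  cases q with
  | nil => exact hne rfl
  | @cons _ c _ e' q =>
    rw [SimpleGraph.Walk.concat_cons, isInducedPath_cons_iff] at hq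
    have hc := hq.2.2 z (SimpleGraph.Walk.end_mem_support _) hxz
    subst hc
    have := (SimpleGraph.Walk.isPath_iff_nil.1 hq.1.1).eq_nil
    have hl := congrArg SimpleGraph.Walk.length this
    simp at hl

end

namespace IsShadowClosed

variable {A B : Set V} {x y z u w : V} {α β : V → Bool}

/-- Let `x` and `y` be nonadjacent boundary vertices, let `z ∈ A` be adjacent to `x` only, and let
`v ∈ B` have a neighbor in `A`. The induced path `(y, v, x, z)` yields the constraint `y → x`; as
`x` and `y` have opposite values, `y` is false in all solutions. -/
theorem adj_left_of_not_adj (h : IsShadowClosed G A B) (hx : x ∈ boundary G (residue A B))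
    (hy : y ∈ boundary G (residue A B)) (hyn : y ∈ nontrivial G A B) (hne : x ≠ y)
    (hna : ¬ G.Adj x y) (hz : z ∈ A) (hxz : G.Adj x z) : G.Adj y z := by
  by_contra hyz
  obtain ⟨u, hu, v, hv, e⟩ := h.exists_adj
  have hv' : v ∈ relBoundary G B A := ⟨hv, u, hu, e.symm⟩
  have hxv := h.adj_relBoundary_right hx hv'
  have hyv := h.adj_relBoundary_right hy hv'
  -- a neighbor `z` of `v` in `A` would be adjacent to all boundary vertices of the residue
  have hvz : ¬ G.Adj v z := fun hvz => hyz (h.adj_relBoundary_left hy ⟨hz, v, hv, hvz.symm⟩)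
  have hi : Implies G A y x := by
    refine ⟨z, hz, .cons hyv (.cons hxv.symm .nil), hxz, ?_⟩
    have h1 : y ≠ z := by rintro rfl; exact notMem_left_of_mem_residue hy.1 hz
    have h2 : v ≠ z := by rintro rfl; exact Set.disjoint_left.1 h.disjoint hz hv
    have h3 := hxz.ne
    have h4 := hxv.ne
    have h5 := hyv.ne
    have h6 : ¬ G.Adj y x := fun e => hna e.symm
    simp only [SimpleGraph.Walk.concat_cons, SimpleGraph.Walk.concat_nil, isInducedPath_cons_iff,
      isInducedPath_nil, SimpleGraph.Walk.support_cons,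
      SimpleGraph.Walk.support_nil, List.mem_cons, List.not_mem_nil, or_false]
    grind
  obtain ⟨-, ⟨α, hα, hay⟩, -⟩ := hyn
  exact hα.difference x hx y hy hne hna ((hα.impliesA y hy x hx hi hay).trans hay.symm)

/-- Nonadjacent nontrivial boundary vertices have the same neighbors outside the residue. -/
theorem typeLE_of_not_adj (h : IsShadowClosed G A B)
    (hx : x ∈ nontrivial G A B ∩ boundary G (residue A B))
    (hy : y ∈ nontrivial G A B ∩ boundary G (residue A B)) (hne : x ≠ y)
    (hna : ¬ G.Adj x y) : TypeLE G A B x y := by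
  refine ⟨fun z hz e => h.adj_left_of_not_adj hx.2 hy.2 hy.1 hne hna hz e, fun z hz e => ?_⟩
  refine h.symm.adj_left_of_not_adj (x := y) (y := x) ?_ ?_ ?_ hne.symm (fun e => hna e.symm) hz e
  · rw [residue_comm]; exact hy.2
  · rw [residue_comm]; exact hx.2
  · rw [nontrivial_comm]; exact hx.1

/-- Boundary vertices of different types are adjacent, so a vertex witnessing that the type of `x`
is not below that of `y` gives an induced path on three vertices and with it the constraint that
`x` is true whenever `y` is. -/
theorem true_of_not_typeLE (h : IsShadowClosed G A B)
    (hx : x ∈ nontrivial G A B ∩ boundary G (residue A B))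
    (hy : y ∈ nontrivial G A B ∩ boundary G (residue A B)) (hn : ¬ TypeLE G A B x y)
    (hα : IsSolution G A B α) (hay : α y = true) : α x = true := by
  have hne : x ≠ y := by rintro rfl; exact hn (TypeLE.refl _ _ _)
  have hxy : G.Adj x y := by
    by_contra hna
    exact hn (h.typeLE_of_not_adj hx hy hne hna)
  by_cases h1 : ∀ z ∈ A, G.Adj x z → G.Adj y z
  · have h2 : ¬ ∀ z ∈ B, G.Adj y z → G.Adj x z := fun h2 => hn ⟨h1, h2⟩
    push Not at h2
    obtain ⟨z, hz, hyz, hxz⟩ := h2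
    by_contra hax
    have := hα.impliesB x hx.2 y hy.2 (implies_of_adj hxy hz hyz hxz (by
      rintro rfl; exact notMem_right_of_mem_residue hx.2.1 hz)) (by simpa using hax)
    simp_all
  · push Not at h1
    obtain ⟨z, hz, hxz, hyz⟩ := h1
    exact hα.impliesA y hy.2 x hx.2 (implies_of_adj hxy.symm hz hxz hyz (by
      rintro rfl; exact notMem_left_of_mem_residue hy.2.1 hz)) hay

/-- If the nontrivial boundary vertices do not all have the same type, then they form a clique:
two nonadjacent ones have the same type and complementary values, so a vertex of another type
would be forced. -/
theorem adj_of_not_typeLE (h : IsShadowClosed G A B)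
    (hu : u ∈ nontrivial G A B ∩ boundary G (residue A B))
    (hw : w ∈ nontrivial G A B ∩ boundary G (residue A B)) (hn : ¬ TypeLE G A B u w)
    (hx : x ∈ nontrivial G A B ∩ boundary G (residue A B))
    (hy : y ∈ nontrivial G A B ∩ boundary G (residue A B)) (hne : x ≠ y) : G.Adj x y := by
  by_contra hna
  have hxy := h.typeLE_of_not_adj hx hy hne hna
  have hyx := h.typeLE_of_not_adj hy hx hne.symm fun e => hna e.symm
  by_cases hux : TypeLE G A B u x
  · have hxw : ¬ TypeLE G A B x w := fun h => hn (hux.trans h)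
    have hyw : ¬ TypeLE G A B y w := fun h => hxw (hxy.trans h)
    obtain ⟨⟨-, ⟨α, hα, haw⟩, -⟩, -⟩ := id hw
    refine hα.difference x hx.2 y hy.2 hne hna ?_
    rw [h.true_of_not_typeLE hx hw hxw hα haw, h.true_of_not_typeLE hy hw hyw hα haw]
  · have huy : ¬ TypeLE G A B u y := fun h => hux (h.trans hyx)
    obtain ⟨⟨-, -, ⟨α, hα, hau⟩⟩, -⟩ := id hu
    refine hα.difference x hx.2 y hy.2 hne hna ?_
    have h1 : α x = false := by
      by_contra hc
      simp_all [h.true_of_not_typeLE hu hx hux hα (by simpa using hc)]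
    have h2 : α y = false := by
      by_contra hc
      simp_all [h.true_of_not_typeLE hu hy huy hα (by simpa using hc)]
    rw [h1, h2]

/-- A solution that serves as the reference point for the orientation of the cells. As soon as
there is an implication constraint between nontrivial variables, it makes all nontrivial
variables true. -/
theorem exists_reference (h : IsShadowClosed G A B) (hβ : IsSolution G A B β) :
    ∃ α, IsSolution G A B α ∧ ∀ u ∈ nontrivial G A B ∩ boundary G (residue A B),
      ∀ w ∈ nontrivial G A B ∩ boundary G (residue A B), ¬ TypeLE G A B u w →
        ∀ x ∈ nontrivial G A B, α x = true := by
  classical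
  by_cases hex : ∃ u ∈ nontrivial G A B ∩ boundary G (residue A B),
      ∃ w ∈ nontrivial G A B ∩ boundary G (residue A B), ¬ TypeLE G A B u w
  · obtain ⟨u, hu, w, hw, hn⟩ := hex
    refine ⟨fun x => if x ∈ nontrivial G A B then true else β x, ?_, fun _ _ _ _ _ x hx => by
      simp [hx]⟩
    have triv : ∀ {x}, x ∈ residue A B → x ∉ nontrivial G A B → ∀ {γ}, IsSolution G A B γ →
        γ x = β x := fun hx hxn _ hγ => eq_of_notMem_nontrivial hx hxn hγ hβ
    refine ⟨fun x hx w hw => ?_, fun x hx y hy hne hna => ?_, fun x hx y hy hi hx1 => ?_,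
      fun x hx y hy hi hx1 => ?_⟩
    · have hl : Linked G A B x w := Or.inl fun α hα => hα.equality x hx w hw
      by_cases hxn : x ∈ nontrivial G A B
      · simp [hxn, hl.mem_nontrivial hxn hw.1.1]
      · have : w ∉ nontrivial G A B := fun hwn => hxn (hl.symm.mem_nontrivial hwn hx)
        simp [hxn, this, hβ.equality x hx w hw]
    · have hl : Linked G A B x y := Or.inr fun α hα => hα.difference x hx y hy hne hna
      by_cases hxn : x ∈ nontrivial G A B
      · have hyn := hl.mem_nontrivial hxn hy.1
        exact (hna (h.adj_of_not_typeLE hu hw hn ⟨hxn, hx⟩ ⟨hyn, hy⟩ hne)).elim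
      · have : y ∉ nontrivial G A B := fun hyn => hxn (hl.symm.mem_nontrivial hyn hx.1)
        simpa [hxn, this] using hβ.difference x hx y hy hne hna
    · by_cases hyn : y ∈ nontrivial G A B
      · simp [hyn]
      · by_cases hxn : x ∈ nontrivial G A B
        · obtain ⟨-, ⟨γ, hγ, hgx⟩, -⟩ := hxn
          simpa [hyn, ← triv hy.1 hyn hγ] using hγ.impliesA x hx y hy hi hgx
        · simp only [hxn, hyn, if_false] at hx1 ⊢
          exact hβ.impliesA x hx y hy hi hx1
    · by_cases hxn : x ∈ nontrivial G A B
      · simp [hxn] at hx1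
      · simp only [hxn, if_false] at hx1
        have hyn : y ∉ nontrivial G A B := by
          rintro ⟨-, ⟨γ, hγ, hgy⟩, -⟩
          have := hγ.impliesB x hx y hy hi ((triv hx.1 hxn hγ).trans hx1)
          simp_all
        simpa [hyn] using hβ.impliesB x hx y hy hi hx1
  · push Not at hex
    exact ⟨β, hβ, fun u hu w hw hn => (hn (hex u hu w hw)).elim⟩

/-- Each class of nontrivial variables contains a boundary vertex of the residue. -/
theorem exists_linked_boundary (h : IsShadowClosed G A B) (hx : x ∈ nontrivial G A B) :
    ∃ y ∈ nontrivial G A B ∩ boundary G (residue A B), Linked G A B x y := by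
  obtain ⟨y, hy⟩ := h.exists_mem_separatorSet hx.1
  have hl : Linked G A B x y := Or.inl fun α hα => hα.equality x hx.1 y hy
  exact ⟨y, ⟨hl.mem_nontrivial hx hy.1.1, hy.1⟩, hl⟩

/-- If `α` is a reference solution, then the solutions are the assignments with the right trivial
values whose agreement set with `α` is a union of classes and closed upwards. -/
theorem isSolution_iff (h : IsShadowClosed G A B) (hα : IsSolution G A B α)
    (href : ∀ u ∈ nontrivial G A B ∩ boundary G (residue A B),
      ∀ w ∈ nontrivial G A B ∩ boundary G (residue A B), ¬ TypeLE G A B u w →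
        ∀ x ∈ nontrivial G A B, α x = true) :
    IsSolution G A B β ↔
      (∀ x ∈ residue A B, x ∉ nontrivial G A B → β x = α x) ∧
      (∀ x ∈ nontrivial G A B, ∀ y ∈ nontrivial G A B, Linked G A B x y →
        (β x = α x ↔ β y = α y)) ∧
      ∀ x ∈ nontrivial G A B, ∀ y ∈ nontrivial G A B, Above G A B x y →
        β y = α y → β x = α x := by
  constructor
  · intro hβ
    refine ⟨fun x hx hn => eq_of_notMem_nontrivial hx hn hβ hα,
      fun x _ y _ hl => hl.agree_iff hα hβ, ?_⟩
    rintro x hx y hy ⟨-, x', hx', y', hy', hxx', hyy', hn⟩ hβy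
    have ht := href x' hx' y' hy' hn
    rw [ht y hy] at hβy
    rw [hyy'.eq_of_eq hα ((ht y hy).trans (ht y' hy'.1).symm) hβ] at hβy
    rw [ht x hx, hxx'.eq_of_eq hα ((ht x hx).trans (ht x' hx'.1).symm) hβ]
    exact h.true_of_not_typeLE hx' hy' hn hβ hβy
  · rintro ⟨htriv, hcls, hab⟩
    have heq : ∀ x ∈ residue A B, ∀ y ∈ residue A B,
        Linked G A B x y → (β x = α x ↔ β y = α y) := by
      intro x hx y hy hl
      by_cases hxn : x ∈ nontrivial G A B
      · exact hcls x hxn y (hl.mem_nontrivial hxn hy) hl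
      · have : y ∉ nontrivial G A B := fun hyn => hxn (hl.symm.mem_nontrivial hyn hx)
        simp [htriv x hx hxn, htriv y hy this]
    -- the nontrivial end points of an implication constraint both have reference value `true`
    have himp : ∀ x ∈ nontrivial G A B ∩ boundary G (residue A B),
        ∀ y ∈ nontrivial G A B ∩ boundary G (residue A B), ¬ TypeLE G A B y x →
          β x = true → β y = true := by
      intro x hx y hy hn hbx
      have ht := href y hy x hx hn
      rw [← ht y hy.1]
      rw [← ht x hx.1] at hbx
      by_cases hl : Linked G A B x y
      · exact (hcls x hx.1 y hy.1 hl).1 hbx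
      · exact hab y hy.1 x hx.1 ⟨fun h => hl h.symm, y, hy, x, hx, Or.inl fun _ _ => rfl,
          Or.inl fun _ _ => rfl, hn⟩ hbx
    refine ⟨fun x hx w hw => ?_, fun x hx y hy hne hna => ?_, fun x hx y hy hi hbx => ?_,
      fun x hx y hy hi hbx => ?_⟩
    · have h1 := heq x hx w hw.1.1 (Or.inl fun α hα => hα.equality x hx w hw)
      have h2 := hα.equality x hx w hw
      cases hx : α x <;> cases hw : α w <;> cases hx' : β x <;> cases hw' : β w <;> simp_all
    · have h1 := heq x hx.1 y hy.1 (Or.inr fun α hα => hα.difference x hx y hy hne hna)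
      have h2 := hα.difference x hx y hy hne hna
      cases hx : α x <;> cases hw : α y <;> cases hx' : β x <;> cases hw' : β y <;> simp_all
    · by_cases hxy : x = y
      · exact hxy ▸ hbx
      by_cases hxn : x ∈ nontrivial G A B
      · by_cases hyn : y ∈ nontrivial G A B
        · obtain ⟨z, hz, hyz, hxz⟩ := hi.exists_adj hxy
          exact himp x ⟨hxn, hx⟩ y ⟨hyn, hy⟩ (fun hle => hxz (hle.1 z hz hyz)) hbx
        · obtain ⟨-, ⟨γ, hγ, hgx⟩, -⟩ := hxn
          rw [htriv y hy.1 hyn, eq_of_notMem_nontrivial hy.1 hyn hα hγ]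
          exact hγ.impliesA x hx y hy hi hgx
      · rw [htriv x hx.1 hxn] at hbx
        have hyn : y ∉ nontrivial G A B := by
          rintro ⟨-, -, γ, hγ, hgy⟩
          have := hγ.impliesA x hx y hy hi ((eq_of_notMem_nontrivial hx.1 hxn hγ hα).trans hbx)
          simp_all
        rw [htriv y hy.1 hyn]
        exact hα.impliesA x hx y hy hi hbx
    · by_cases hxy : x = y
      · exact hxy ▸ hbx
      by_cases hxn : x ∈ nontrivial G A B
      · by_cases hyn : y ∈ nontrivial G A B
        · obtain ⟨z, hz, hyz, hxz⟩ := hi.exists_adj hxy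
          by_contra hby
          have := himp y ⟨hyn, hy⟩ x ⟨hxn, hx⟩ (fun hle => hxz (hle.2 z hz hyz))
            (by simpa using hby)
          simp_all
        · obtain ⟨-, -, γ, hγ, hgx⟩ := hxn
          rw [htriv y hy.1 hyn, eq_of_notMem_nontrivial hy.1 hyn hα hγ]
          exact hγ.impliesB x hx y hy hi hgx
      · rw [htriv x hx.1 hxn] at hbx
        have hyn : y ∉ nontrivial G A B := by
          rintro ⟨-, ⟨γ, hγ, hgy⟩, -⟩
          have := hγ.impliesB x hx y hy hi ((eq_of_notMem_nontrivial hx.1 hxn hγ hα).trans hbx)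
          simp_all
        rw [htriv y hy.1 hyn]
        exact hα.impliesB x hx y hy hi hbx

/-! ### The order of the classes -/

theorem true_of_above (h : IsShadowClosed G A B) (hx : x ∈ nontrivial G A B)
    (hy : y ∈ nontrivial G A B) (hxy : Above G A B x y) (hβ : IsSolution G A B β)
    (hby : β y = true) : β x = true := by
  obtain ⟨α, hα, href⟩ := h.exists_reference hβ
  obtain ⟨-, x', hx', y', hy', -, -, hn⟩ := id hxy
  have ht := href x' hx' y' hy' hn
  rw [← ht x hx]
  rw [← ht y hy] at hby
  exact ((h.isSolution_iff hα href).1 hβ).2.2 x hx y hy hxy hby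

theorem above_asymm (h : IsShadowClosed G A B) (hx : x ∈ nontrivial G A B)
    (hy : y ∈ nontrivial G A B) (hxy : Above G A B x y) : ¬ Above G A B y x := by
  refine fun hyx => hxy.1 (Or.inl fun α hα => ?_)
  rw [Bool.eq_iff_iff]
  exact ⟨h.true_of_above hy hx hyx hα, h.true_of_above hx hy hxy hα⟩

/-- Negative transitivity of `Above`, which holds because the order of types is transitive. -/
theorem above_or_above (h : IsShadowClosed G A B) (hy : y ∈ nontrivial G A B)
    (hxz : Above G A B x z) : Above G A B x y ∨ Above G A B y z := by
  obtain ⟨hl, x', hx', z', hz', hxx', hzz', hn⟩ := hxz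
  obtain ⟨y', hy', hyy'⟩ := h.exists_linked_boundary hy
  by_cases hn' : TypeLE G A B x' y'
  · have hn'' : ¬ TypeLE G A B y' z' := fun h => hn (hn'.trans h)
    by_cases hyz : Linked G A B y z
    · exact Or.inl ⟨fun h => hl (h.trans hyz), x', hx', z', hz', hxx', hyz.trans hzz', hn⟩
    · exact Or.inr ⟨hyz, y', hy', z', hz', hyy', hzz', hn''⟩
  · by_cases hxy : Linked G A B x y
    · exact Or.inr ⟨fun h => hl (hxy.trans h), x', hx', z', hz', hxy.symm.trans hxx', hzz', hn⟩
    · exact Or.inl ⟨hxy, x', hx', y', hy', hxx', hyy', hn'⟩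

/-- The relation `Above` is a strict weak order, and the number of elements above a vertex is a
rank function for it. -/
theorem above_iff_ncard_lt [Finite V] (h : IsShadowClosed G A B) (hx : x ∈ nontrivial G A B)
    (hy : y ∈ nontrivial G A B) :
    Above G A B x y ↔ {z | z ∈ nontrivial G A B ∧ Above G A B z x}.ncard <
      {z | z ∈ nontrivial G A B ∧ Above G A B z y}.ncard := by
  constructor
  · intro hxy
    refine Set.ncard_lt_ncard ⟨fun z hz => ⟨hz.1, ?_⟩, fun hs => ?_⟩
    · exact (h.above_or_above hy hz.2).resolve_right (h.above_asymm hx hy hxy)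
    · have := (hs ⟨hx, hxy⟩).2
      exact h.above_asymm hx hx this this
  · intro hlt
    by_contra hxy
    refine hlt.not_ge (Set.ncard_le_ncard fun z hz => ⟨hz.1, ?_⟩)
    exact (h.above_or_above hx hz.2).resolve_right hxy

end IsShadowClosed

/-! ### Assembled sets -/

namespace CellPartition

variable (D : CellPartition G a b)

/-- The cell `C'ᵢ` (rather than `C''ᵢ`) is taken by the assembled set of `l` and `S`. -/
def Chosen (l : Fin D.p) (S : Finset (Fin D.k)) (i : Fin D.k) : Prop :=
  D.block i < l ∨ i ∈ S

variable {D} {l : Fin D.p} {S : Finset (Fin D.k)} {x : V} {i : Fin D.k}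

theorem mem_blockSet {j : Fin D.p} : i ∈ D.blockSet j ↔ D.block i = j := by
  simp [blockSet]

theorem mem_assemble (hS : S ⊆ D.blockSet l) :
    x ∈ D.assemble l S ↔ x ∈ core G a b ∨ (∃ i, D.Chosen l S i ∧ x ∈ D.left i) ∨
      ∃ i, ¬ D.Chosen l S i ∧ x ∈ D.right i := by
  have h : ∀ i, (i ∈ D.blockSet l \ S ∨ l < D.block i) ↔ ¬ D.Chosen l S i := by
    intro i
    have hi : i ∈ S → D.block i = l := fun h => mem_blockSet.1 (hS h)
    rw [Chosen, Finset.mem_sdiff, mem_blockSet]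
    rcases lt_trichotomy (D.block i) l with h | h | h
    · simp [h, h.ne, h.le]
    · simp [h]
    · simp [h, h.ne', h.le, mt hi h.ne']
  simp only [assemble, Set.mem_union, Set.mem_iUnion, Set.mem_ofPred_eq, exists_prop, h, or_assoc]
  rfl

theorem mem_nontrivialVars (h : x ∈ D.left i ∪ D.right i) : x ∈ nontrivialVars G a b := by
  rw [← D.cover]
  exact Set.mem_iUnion.2 ⟨i, h⟩

theorem index_unique {j : Fin D.k} (hi : x ∈ D.left i ∪ D.right i)
    (hj : x ∈ D.left j ∪ D.right j) : i = j := by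
  by_contra hne
  exact Set.disjoint_left.1 (D.disjoint i j hne) hi hj

end CellPartition

theorem notMem_core_of_mem_nontrivialVars {x : V} (hx : x ∈ nontrivialVars G a b) :
    x ∉ core G a b := by
  rintro (h | h)
  · exact notMem_left_of_mem_residue hx.1 h
  · obtain ⟨-, -, α, hα, hax⟩ := hx
    exact Bool.false_ne_true (hax.symm.trans (h.2 α hα))

namespace CellPartition

variable {D : CellPartition G a b} {l : Fin D.p} {S : Finset (Fin D.k)} {x : V} {i : Fin D.k}

theorem mem_assemble_of_mem_left (hS : S ⊆ D.blockSet l) (hx : x ∈ D.left i) :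
    x ∈ D.assemble l S ↔ D.Chosen l S i := by
  rw [mem_assemble hS]
  constructor
  · rintro (h | ⟨j, hj, h⟩ | ⟨j, -, h⟩)
    · exact (notMem_core_of_mem_nontrivialVars (D.mem_nontrivialVars (Or.inl hx)) h).elim
    · rwa [index_unique (Or.inl hx) (Or.inl h)]
    · obtain rfl := index_unique (Or.inl hx) (Or.inr h)
      exact (Set.disjoint_left.1 (D.disjoint_twin i) hx h).elim
  · exact fun h => Or.inr (Or.inl ⟨i, h, hx⟩)

theorem mem_assemble_of_mem_right (hS : S ⊆ D.blockSet l) (hx : x ∈ D.right i) :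
    x ∈ D.assemble l S ↔ ¬ D.Chosen l S i := by
  rw [mem_assemble hS]
  constructor
  · rintro (h | ⟨j, -, h⟩ | ⟨j, hj, h⟩)
    · exact (notMem_core_of_mem_nontrivialVars (D.mem_nontrivialVars (Or.inr hx)) h).elim
    · obtain rfl := index_unique (Or.inr hx) (Or.inl h)
      exact (Set.disjoint_left.1 (D.disjoint_twin i) h hx).elim
    · rwa [index_unique (Or.inr hx) (Or.inr h)]
  · exact fun h => Or.inr (Or.inr ⟨i, h, hx⟩)

theorem mem_assemble_of_notMem (hS : S ⊆ D.blockSet l) (hx : x ∉ nontrivialVars G a b) :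
    x ∈ D.assemble l S ↔ x ∈ core G a b := by
  rw [mem_assemble hS]
  constructor
  · rintro (h | ⟨j, -, h⟩ | ⟨j, hj, h⟩)
    · exact h
    · exact (hx (D.mem_nontrivialVars (Or.inl h))).elim
    · exact (hx (D.mem_nontrivialVars (Or.inr h))).elim
  · exact Or.inl

/-! ### The VC-dimension of a cell decomposition -/

theorem chosen_iff_of_block_eq {T : Finset (Fin D.k)} (hi : D.block i = l) :
    D.Chosen l T i ↔ i ∈ T := by
  simp [Chosen, hi]

/-- Of two cells in distinct blocks, the one in the later block is not chosen without the
other. -/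
theorem Chosen.of_block_lt {j : Fin D.k} (hS : S ⊆ D.blockSet l) (hij : D.block i < D.block j)
    (hj : D.Chosen l S j) : D.Chosen l S i := by
  rcases hj with h | h
  · exact Or.inl (hij.trans h)
  · exact Or.inl (mem_blockSet.1 (hS h) ▸ hij)

variable [Fintype V] [DecidableEq V]

/-- One vertex from each class of a block gives a shattered set. -/
theorem exists_shatters (hD : D.IsCellDecomposition) (j : Fin D.p) :
    ∃ s : Finset V, (halfspaces G a b).Shatters s ∧ s.card = (D.blockSet j).card := by
  classical
  choose r hr using D.nonempty
  have hinj : Function.Injective r := fun i i' h => index_unique (hr i) (h ▸ hr i')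
  refine ⟨(D.blockSet j).image r, fun t ht => ?_, Finset.card_image_of_injective _ hinj⟩
  set S := (D.blockSet j).filter fun i => (r i ∈ t ↔ r i ∈ D.left i) with hSdef
  have hS : S ⊆ D.blockSet j := Finset.filter_subset _ _
  refine ⟨(D.assemble j S).toFinset, (hD _).2 ⟨j, S, hS, by simp⟩, ?_⟩
  have key : ∀ i ∈ D.blockSet j, (r i ∈ D.assemble j S ↔ r i ∈ t) := by
    intro i hi
    have hc : D.Chosen j S i ↔ (r i ∈ t ↔ r i ∈ D.left i) := by
      rw [chosen_iff_of_block_eq (mem_blockSet.1 hi), hSdef, Finset.mem_filter]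
      simp [hi]
    rcases hr i with h | h
    · rw [mem_assemble_of_mem_left hS h, hc]
      simp [h]
    · have hl : r i ∉ D.left i := fun h' => Set.disjoint_left.1 (D.disjoint_twin i) h' h
      rw [mem_assemble_of_mem_right hS h, hc]
      simp [hl]
  ext x
  simp only [Finset.mem_inter, Finset.mem_image, Set.mem_toFinset]
  constructor
  · rintro ⟨⟨i, hi, rfl⟩, hx⟩
    exact (key i hi).1 hx
  · intro hx
    obtain ⟨i, hi, rfl⟩ := Finset.mem_image.1 (ht hx)
    exact ⟨⟨i, hi, rfl⟩, (key i hi).2 hx⟩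

/-- The vertices of a shattered set lie in distinct classes of a single block. -/
theorem exists_card_le_of_shatters (hD : D.IsCellDecomposition) (hp : Nonempty (Fin D.p))
    {s : Finset V} (hs : (halfspaces G a b).Shatters s) :
    ∃ j, s.card ≤ (D.blockSet j).card := by
  classical
  -- each trace on `s` is the trace of an assembled set
  have trace : ∀ t ⊆ s, ∃ l S, S ⊆ D.blockSet l ∧ ∀ x ∈ s, x ∈ D.assemble l S ↔ x ∈ t := by
    intro t ht
    obtain ⟨H, hH, rfl⟩ := hs ht
    obtain ⟨l, S, hS, hHS⟩ := (hD H).1 hH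
    refine ⟨l, S, hS, fun x hx => ?_⟩
    rw [← hHS]
    simp [hx]
  have hnt : ∀ x ∈ s, ∃ i, x ∈ D.left i ∪ D.right i := by
    intro x hx
    have : x ∈ nontrivialVars G a b := by
      by_contra hn
      obtain ⟨l, S, hS, h⟩ := trace ∅ (by simp)
      obtain ⟨l', S', hS', h'⟩ := trace {x} (by simpa using hx)
      have h1 := h x hx
      have h2 := h' x hx
      rw [mem_assemble_of_notMem hS hn] at h1
      rw [mem_assemble_of_notMem hS' hn] at h2
      simp_all
    rwa [← D.cover, Set.mem_iUnion] at this
  rcases s.eq_empty_or_nonempty with rfl | ⟨x, hx⟩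
  · obtain ⟨j⟩ := hp
    exact ⟨j, by simp⟩
  have : Nonempty (Fin D.k) := ⟨(hnt x hx).choose⟩
  choose! c hc using hnt
  have hinj : Set.InjOn c s := by
    intro x hx y hy hxy
    by_contra hne
    have hy' := hc y hy
    rw [← hxy] at hy'
    -- two vertices of one class cannot realize all four traces
    obtain ⟨l₁, S₁, hS₁, h₁⟩ := trace {x} (by simpa using hx)
    obtain ⟨l₂, S₂, hS₂, h₂⟩ := trace {x, y} (by
      intro z hz
      simp only [Finset.mem_insert, Finset.mem_singleton] at hz
      rcases hz with rfl | rfl <;> assumption)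
    have hx₁ := h₁ x hx
    have hy₁ := h₁ y hy
    have hx₂ := h₂ x hx
    have hy₂ := h₂ y hy
    simp only [Finset.mem_singleton, Finset.mem_insert, true_or, or_true, iff_true,
      Ne.symm hne, iff_false] at hx₁ hy₁ hx₂ hy₂
    rcases hc x hx with h | h <;> rcases hy' with h' | h'
    · rw [mem_assemble_of_mem_left hS₁ h] at hx₁
      rw [mem_assemble_of_mem_left hS₁ h'] at hy₁
      exact hy₁ hx₁
    · rw [mem_assemble_of_mem_left hS₂ h] at hx₂
      rw [mem_assemble_of_mem_right hS₂ h'] at hy₂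
      exact hy₂ hx₂
    · rw [mem_assemble_of_mem_right hS₂ h] at hx₂
      rw [mem_assemble_of_mem_left hS₂ h'] at hy₂
      exact hx₂ hy₂
    · rw [mem_assemble_of_mem_right hS₁ h] at hx₁
      rw [mem_assemble_of_mem_right hS₁ h'] at hy₁
      exact hy₁ hx₁
  -- an assignment of values to the classes of two vertices is realized
  have realize : ∀ x ∈ s, ∀ y ∈ s, x ≠ y → ∃ l S, S ⊆ D.blockSet l ∧
      ¬ D.Chosen l S (c x) ∧ D.Chosen l S (c y) := by
    intro x hx y hy hne
    obtain ⟨l, S, hS, h⟩ := trace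
      (s.filter fun z => (z = x ∧ z ∈ D.right (c z)) ∨ (z = y ∧ z ∈ D.left (c z)))
      (Finset.filter_subset _ _)
    have hx' := h x hx
    have hy' := h y hy
    simp only [Finset.mem_filter, hx, hy, hne, Ne.symm hne, true_and, false_and, or_false,
      false_or] at hx' hy'
    refine ⟨l, S, hS, ?_, ?_⟩
    · rcases hc x hx with hl | hr
      · have : x ∉ D.right (c x) := Set.disjoint_left.1 (D.disjoint_twin _) hl
        rw [mem_assemble_of_mem_left hS hl] at hx'
        exact mt hx'.1 this
      · rw [mem_assemble_of_mem_right hS hr] at hx'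
        exact hx'.2 hr
    · rcases hc y hy with hl | hr
      · rw [mem_assemble_of_mem_left hS hl] at hy'
        exact hy'.2 hl
      · have : y ∉ D.left (c y) := fun hl => Set.disjoint_left.1 (D.disjoint_twin _) hl hr
        rw [mem_assemble_of_mem_right hS hr] at hy'
        exact not_not.1 (mt hy'.1 this)
  have hblock : ∀ x ∈ s, ∀ y ∈ s, ¬ D.block (c x) < D.block (c y) := by
    intro x hx y hy hlt
    obtain ⟨l, S, hS, h1, h2⟩ := realize x hx y hy (by rintro rfl; exact lt_irrefl _ hlt)
    exact h1 (h2.of_block_lt hS hlt)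
  refine ⟨D.block (c x), Finset.card_le_card_of_injOn c (fun y hy => ?_) hinj⟩
  exact mem_blockSet.2 (le_antisymm (not_lt.1 (hblock x hx y hy)) (not_lt.1 (hblock y hy x hx)))

/-- The VC-dimension is the largest number of cells in a block. -/
theorem isGreatest_vcDim (hD : D.IsCellDecomposition) (hne : (halfspaces G a b).Nonempty) :
    IsGreatest (Set.range fun j : Fin D.p => (D.blockSet j).card) (halfspaces G a b).vcDim := by
  have hp : Nonempty (Fin D.p) := by
    obtain ⟨H, hH⟩ := hne
    obtain ⟨l, -⟩ := (hD H).1 hH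
    exact ⟨l⟩
  have hub : ∀ j, (D.blockSet j).card ≤ (halfspaces G a b).vcDim := by
    intro j
    obtain ⟨s, hs, hc⟩ := exists_shatters hD j
    exact hc ▸ hs.card_le_vcDim
  refine ⟨?_, by rintro _ ⟨j, rfl⟩; exact hub j⟩
  have hsne : (halfspaces G a b).shatterer.Nonempty :=
    ⟨∅, Finset.mem_shatterer.2 (Finset.shatters_empty.2 hne)⟩
  obtain ⟨s, hs, hcard⟩ := Finset.exists_mem_eq_sup _ hsne Finset.card
  obtain ⟨j, hj⟩ := exists_card_le_of_shatters hD hp (Finset.mem_shatterer.1 hs)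
  exact ⟨j, (hub j).antisymm (hcard.le.trans hj)⟩

end CellPartition

/-! ### Construction of a cell decomposition -/

/-- Grouping the elements of `Fin k` into blocks by the values of a rank function. -/
theorem exists_blocks {k : ℕ} (r : Fin k → ℕ) :
    ∃ (p : ℕ) (block : Fin k → Fin p), (0 < k → Function.Surjective block) ∧ (k = 0 → p = 1) ∧
      0 < p ∧ ∀ i j, block i < block j ↔ r i < r j := by
  rcases Nat.eq_zero_or_pos k with rfl | hk
  · exact ⟨1, Fin.elim0, by simp, by simp, by simp, fun i => i.elim0⟩
  · set I := Finset.univ.image r with hI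
    have hmem : ∀ i, r i ∈ I := fun i => Finset.mem_image_of_mem _ (Finset.mem_univ i)
    refine ⟨I.card, fun i => (I.orderIsoOfFin rfl).symm ⟨r i, hmem i⟩, fun _ j => ?_, by omega,
      Finset.card_pos.2 ⟨_, hmem ⟨0, hk⟩⟩, fun i j => by simp⟩
    obtain ⟨i, -, hi⟩ := Finset.mem_image.1 (I.orderIsoOfFin rfl j).2
    refine ⟨i, ?_⟩
    rw [OrderIso.symm_apply_eq]
    exact Subtype.ext hi

/-- A set of indices that is closed towards earlier blocks consists of all indices before some
block and of some indices of that block. -/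
theorem exists_threshold {k p : ℕ} (hp : 0 < p) (block : Fin k → Fin p) (T : Fin k → Prop)
    (hT : ∀ i j, block i < block j → T j → T i) :
    ∃ l : Fin p, ∀ i, (block i < l → T i) ∧ (l < block i → ¬ T i) := by
  classical
  by_cases hex : ∃ i, T i
  · obtain ⟨j, hj, hmax⟩ := (Finset.univ.filter T).exists_max_image block
      (by obtain ⟨i, hi⟩ := hex; exact ⟨i, by simpa using hi⟩)
    simp only [Finset.mem_filter, Finset.mem_univ, true_and] at hj hmax
    exact ⟨block j, fun i => ⟨fun h => hT i j h hj, fun h hi => (hmax i hi).not_gt h⟩⟩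
  · push Not at hex
    exact ⟨⟨0, hp⟩, fun i => ⟨fun h => (Nat.not_lt_zero _ h).elim, fun _ => hex i⟩⟩

/-- The classes of nontrivial variables can be numbered. -/
theorem exists_class_index [Finite V] (A B : Set V) :
    ∃ (k : ℕ) (c : nontrivial G A B → Fin k), Function.Surjective c ∧
      ∀ x y, c x = c y ↔ Linked G A B x y := by
  let s : Setoid (nontrivial G A B) :=
    ⟨fun x y => Linked G A B x y, fun _ => Or.inl fun _ _ => rfl, Linked.symm, Linked.trans⟩
  refine ⟨_, fun x => Finite.equivFin (Quotient s) ⟦x⟧,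
    (Finite.equivFin _).surjective.comp Quotient.mk_surjective, fun x y => ?_⟩
  rw [(Finite.equivFin _).apply_eq_iff_eq, Quotient.eq]
  rfl

/-- The cells of a class are the vertices where a reference solution is true and those where it is
false; the blocks are ordered by the number of variables above a class. -/
theorem exists_isCellDecomposition [Fintype V] (hG : G.Connected) (hab : G.Adj a b)
    (hne : (halfspaces G a b).Nonempty) : ∃ D : CellPartition G a b, D.IsCellDecomposition := by
  classical
  have hP := isShadowClosed_sides hG hab hne
  have hmem : ∀ {H : Finset V}, H ∈ halfspaces G a b ↔ ∃ α, Solves G a b α ∧ (H : Set V) =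
      sideA G a b ∪ {x | x ∈ residue (sideA G a b) (sideB G a b) ∧ α x = true} :=
    mem_halfspaces_iff_exists_solves hG hab hne
  obtain ⟨β, hβ, -⟩ := hmem.1 hne.choose_spec
  obtain ⟨α, hα, href⟩ := hP.exists_reference hβ
  have hsol := fun β => hP.isSolution_iff (β := β) hα href
  obtain ⟨k, c, hc, hcl⟩ := exists_class_index (G := G) (sideA G a b) (sideB G a b)
  choose s hs using hc
  obtain ⟨p, block, hsurj, hone, hpos, hblock⟩ := exists_blocks fun i =>
    {z | z ∈ nontrivial G (sideA G a b) (sideB G a b) ∧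
      Above G (sideA G a b) (sideB G a b) z (s i)}.ncard
  have hsc : ∀ x : nontrivial G (sideA G a b) (sideB G a b),
      Linked G (sideA G a b) (sideB G a b) x (s (c x)) := fun x => by
    rw [← hcl, hs]
  have hblock' : ∀ x y : nontrivial G (sideA G a b) (sideB G a b), block (c x) < block (c y) ↔
      Above G (sideA G a b) (sideB G a b) x y := by
    intro x y
    rw [hblock, ← hP.above_iff_ncard_lt (s _).2 (s _).2]
    constructor
    · rintro ⟨hl, x', hx', y', hy', hxx', hyy', hn⟩
      exact ⟨fun h => hl ((hsc x).symm.trans (h.trans (hsc y))), x', hx', y', hy',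
        (hsc x).trans hxx', (hsc y).trans hyy', hn⟩
    · rintro ⟨hl, x', hx', y', hy', hxx', hyy', hn⟩
      exact ⟨fun h => hl ((hsc x).trans (h.trans (hsc y).symm)), x', hx', y', hy',
        (hsc x).symm.trans hxx', (hsc y).symm.trans hyy', hn⟩
  let D : CellPartition G a b :=
    { k := k
      p := p
      left := fun i => {x | ∃ hx : x ∈ nontrivialVars G a b, c ⟨x, hx⟩ = i ∧ α x = true}
      right := fun i => {x | ∃ hx : x ∈ nontrivialVars G a b, c ⟨x, hx⟩ = i ∧ α x = false}
      block := block
      nonempty := fun i => by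
        refine ⟨s i, ?_⟩
        cases h : α (s i)
        · exact Or.inr ⟨(s i).2, hs i, h⟩
        · exact Or.inl ⟨(s i).2, hs i, h⟩
      disjoint_twin := fun i => by
        rw [Set.disjoint_left]
        rintro x ⟨-, -, h⟩ ⟨-, -, h'⟩
        simp_all
      disjoint := fun i j hij => by
        rw [Set.disjoint_left]
        rintro x (⟨_, h, -⟩ | ⟨_, h, -⟩) (⟨_, h', -⟩ | ⟨_, h', -⟩) <;>
          exact hij (h.symm.trans h')
      cover := by
        ext x
        simp only [Set.mem_iUnion]
        constructor
        · rintro ⟨i, ⟨hx, -⟩ | ⟨hx, -⟩⟩ <;> exact hx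
        · intro hx
          refine ⟨c ⟨x, hx⟩, ?_⟩
          cases h : α x
          · exact Or.inr ⟨hx, rfl, h⟩
          · exact Or.inl ⟨hx, rfl, h⟩
      same_iff := fun x hx y hy => by
        constructor
        · rintro ⟨i, ⟨⟨_, h1, h2⟩, _, h3, h4⟩ | ⟨⟨_, h1, h2⟩, _, h3, h4⟩⟩ γ hγ <;>
            exact ((hcl _ _).1 (h1.trans h3.symm)).eq_of_eq hα (h2.trans h4.symm) hγ
        · intro h
          have hxy : c ⟨x, hx⟩ = c ⟨y, hy⟩ := (hcl _ _).2 (Or.inl h)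
          refine ⟨c ⟨x, hx⟩, ?_⟩
          have he := h α hα
          cases h : α x
          · exact Or.inr ⟨⟨hx, rfl, h⟩, hy, hxy.symm, he.symm.trans h⟩
          · exact Or.inl ⟨⟨hx, rfl, h⟩, hy, hxy.symm, he.symm.trans h⟩
      diff_iff := fun x hx y hy => by
        constructor
        · rintro ⟨i, ⟨⟨_, h1, h2⟩, _, h3, h4⟩ | ⟨⟨_, h1, h2⟩, _, h3, h4⟩⟩ γ hγ <;>
            exact ((hcl _ _).1 (h1.trans h3.symm)).ne_of_ne hα (by simp [h2, h4]) hγ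
        · intro h
          have hxy : c ⟨x, hx⟩ = c ⟨y, hy⟩ := (hcl _ _).2 (Or.inr h)
          refine ⟨c ⟨x, hx⟩, ?_⟩
          have he := h α hα
          cases h : α x
          · exact Or.inr ⟨⟨hx, rfl, h⟩, hy, hxy.symm, by simpa [h] using he⟩
          · exact Or.inl ⟨⟨hx, rfl, h⟩, hy, hxy.symm, by simpa [h] using he⟩
      block_surjective := hsurj
      single_block := hone }
  -- the set described by a solution is assembled from the classes where it agrees with `α`
  have hasm : ∀ {γ : V → Bool} {l : Fin D.p} {S : Finset (Fin D.k)}, S ⊆ D.blockSet l →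
      Solves G a b γ → (∀ x : nontrivial G (sideA G a b) (sideB G a b),
        D.Chosen l S (c x) ↔ γ x = α x) →
      D.assemble l S =
        sideA G a b ∪ {x | x ∈ residue (sideA G a b) (sideB G a b) ∧ γ x = true} := by
    intro γ l S hS hγ hch
    ext x
    by_cases hx : x ∈ nontrivialVars G a b
    · have hxA := notMem_left_of_mem_residue hx.1
      have hxR := hx.1
      have hx' := hch ⟨x, hx⟩
      cases hax : α x
      · rw [CellPartition.mem_assemble_of_mem_right (i := c ⟨x, hx⟩) hS ⟨hx, rfl, hax⟩, hx']
        simp [hxA, hxR, hax]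
      · rw [CellPartition.mem_assemble_of_mem_left (i := c ⟨x, hx⟩) hS ⟨hx, rfl, hax⟩, hx']
        simp [hxA, hxR, hax]
    · rw [CellPartition.mem_assemble_of_notMem hS hx, core, Set.mem_union, Set.mem_union]
      refine or_congr_right (and_congr_right fun hxR => ⟨fun h => h γ hγ, fun h δ hδ => ?_⟩)
      exact (eq_of_notMem_nontrivial hxR hx hδ hγ).trans h
  refine ⟨D, fun H => ?_⟩
  rw [hmem]
  constructor
  · rintro ⟨γ, hγ, hH⟩
    obtain ⟨-, hcls, habove⟩ := (hsol γ).1 hγ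
    have hT : ∀ x, γ (s (c x)) = α (s (c x)) ↔ γ x = α x := fun x =>
      (hcls _ x.2 _ (s (c x)).2 (hsc x)).symm
    obtain ⟨l, hl⟩ := exists_threshold hpos block (fun i => γ (s i) = α (s i)) (by
      intro i j hij
      rw [← hs i, ← hs j, hblock'] at hij
      exact habove _ (s i).2 _ (s j).2 hij)
    have hS : (D.blockSet l).filter (fun i => γ (s i) = α (s i)) ⊆ D.blockSet l :=
      Finset.filter_subset _ _
    refine ⟨l, _, hS, hH.trans (hasm hS hγ fun x => ?_).symm⟩
    rw [← hT x, CellPartition.Chosen, Finset.mem_filter, CellPartition.mem_blockSet]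
    have h1 := hl (c x)
    change block (c x) < l ∨ block (c x) = l ∧ _ ↔ _
    rcases lt_trichotomy (block (c x)) l with h | h | h
    · simp [h, h1.1 h]
    · simp [h]
    · simp [h.ne', h.le, h1.2 h]
  · rintro ⟨l, S, hS, hH⟩
    let γ : V → Bool := fun x => if hx : x ∈ nontrivial G (sideA G a b) (sideB G a b) then
      if D.Chosen l S (c ⟨x, hx⟩) then α x else !α x else α x
    have hγ : ∀ x : nontrivial G (sideA G a b) (sideB G a b),
        D.Chosen l S (c x) ↔ γ x = α x := by
      intro x
      by_cases h : D.Chosen l S (c x) <;> simp [γ, h]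
    have hsolves : Solves G a b γ := by
      refine (hsol γ).2 ⟨fun x _ hx => by simp [γ, hx], fun x hx y hy hxy => ?_,
        fun x hx y hy hxy => ?_⟩
      · rw [← hγ ⟨x, hx⟩, ← hγ ⟨y, hy⟩, (hcl ⟨x, hx⟩ ⟨y, hy⟩).2 hxy]
      · rw [← hγ ⟨x, hx⟩, ← hγ ⟨y, hy⟩]
        exact CellPartition.Chosen.of_block_lt hS ((hblock' ⟨x, hx⟩ ⟨y, hy⟩).2 hxy)
    exact ⟨γ, hsolves, hH.trans (hasm hS hsolves hγ)⟩

end Monophonic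

theorem mainTheorem5 {V : Type*} [Fintype V] [DecidableEq V] (G : SimpleGraph V)
    (hG : G.Connected) (a b : V) (hab : G.Adj a b)
    (hne : (Monophonic.halfspaces G a b).Nonempty) :
    (∃ D : Monophonic.CellPartition G a b, D.IsCellDecomposition) ∧
      ∀ D : Monophonic.CellPartition G a b, D.IsCellDecomposition →
        IsGreatest (Set.range fun j : Fin D.p => (D.blockSet j).card)
          (Monophonic.halfspaces G a b).vcDim :=
  ⟨Monophonic.exists_isCellDecomposition hG hab hne,
    fun _ hD => Monophonic.CellPartition.isGreatest_vcDim hD hne⟩
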